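/- Let $\Lambda$ be the ring of symmetric functions in $X=x_1+x_2+\cdots$ with coefficients in $\mathbb{Q}(q,t)$, with monomial, elementary, complete homogeneous and power-sum symmetric functions $m_\mu$, $e_n$, $h_n$, $p_n$. For $a\in\mathbb{Z}$ and $f\in\Lambda$ define the (Haglund–Morse–Zabrocki) creation operator $$C_a f=\Bigl(-\frac1q\Bigr)^{a-1}\, f\Bigl[X-\frac{1-1/q}{z}\Bigr]\sum_{n\ge 0}h_n z^n\,\Bigg|_{z^a},$$ where $|_{z^a}$ denotes taking the coefficient of $z^a$ and $f\mapsto f[X-\frac{1-1/q}{z}]$ is the $\mathbb{Q}(q,t)$-algebra homomorphism with $p_n\mapsto p_n-(1-q^{-n})z^{-n}$ for all $n\ge1$. For a composition $\alpha=(\alpha_1,\dots,\alpha_r)$ put $C_\alpha=C_{\alpha_1}C_{\alpha_2}\cdots C_{\alpha_r}(1)$. Let $k\ge 1$ and $l\ge 0$ be integers. Then $$(-1)^k m_{2^k1^l}=\binom{k+l}{k}e_{2k+l}+q\sum_{i=1}^{k}\sum_{j=0}^{l}\binom{i-1+j}{i-1}\,C_{2i+j}\bigl((-1)^{k-i}m_{2^{k-i}1^{l-j}}\bigr).$$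 Moreover, $(-1)^k m_{2^k1^l}$ has a $C$-expansion with coefficients in $\mathbb{N}[q]$: there are polynomials $c_\alpha\in\mathbb{N}[q]$, indexed by the compositions $\alpha$ of $2k+l$, such that $$(-1)^k m_{2^k1^l}=\sum_{\alpha\vDash 2k+l}c_\alpha\,C_\alpha .$$ -/

import Mathlib

/-! Symmetric functions in the variables `x_0, x_1, x_2, …`, plethysm on power sums, and the
Haglund-Morse-Zabrocki operators. -/

noncomputable section

namespace SymFn

/-- The multiset of the nonzero exponents of the monomial `x^d`. -/
def exponents (d : ℕ →₀ ℕ) : Multiset ℕ := d.support.val.map d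

theorem exponents_embDomain (σ : ℕ ↪ ℕ) (d : ℕ →₀ ℕ) :
    exponents (d.embDomain σ) = exponents d := by
  simp [exponents, Finsupp.support_embDomain, Finset.map_val, Multiset.map_map]

theorem sum_exponents (d : ℕ →₀ ℕ) : (exponents d).sum = d.degree := rfl

theorem degree_embDomain (σ : ℕ ↪ ℕ) (d : ℕ →₀ ℕ) : (d.embDomain σ).degree = d.degree := by
  rw [← sum_exponents, exponents_embDomain, sum_exponents]

/-- The ring `Λ` of symmetric functions with coefficients in `K`: the formal power series of
bounded degree in `x_0, x_1, x_2, …` that are invariant under all permutations of the variables. -/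
def Sym (K : Type*) [Field K] : Subalgebra K (MvPowerSeries ℕ K) where
  carrier := {f | (∀ σ : Equiv.Perm ℕ, MvPowerSeries.renameEquiv K σ f = f) ∧
    ∃ N : ℕ, ∀ d : ℕ →₀ ℕ, N < d.degree → MvPowerSeries.coeff d f = 0}
  mul_mem' := by
    rintro f g ⟨hf, M, hM⟩ ⟨hg, N, hN⟩
    refine ⟨fun σ => by rw [map_mul, hf, hg], M + N, fun d hd => ?_⟩
    rw [MvPowerSeries.coeff_mul]
    refine Finset.sum_eq_zero fun a ha => ?_
    have h : a.1.degree + a.2.degree = d.degree := by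
      rw [← Finset.HasAntidiagonal.mem_antidiagonal.1 ha, map_add]
    rcases lt_or_ge M a.1.degree with h1 | h1
    · rw [hM _ h1, zero_mul]
    · rw [hN a.2 (by omega), mul_zero]
  add_mem' := by
    rintro f g ⟨hf, M, hM⟩ ⟨hg, N, hN⟩
    refine ⟨fun σ => by rw [map_add, hf, hg], max M N, fun d hd => ?_⟩
    rw [map_add, hM _ (lt_of_le_of_lt (le_max_left _ _) hd),
      hN _ (lt_of_le_of_lt (le_max_right _ _) hd), add_zero]
  algebraMap_mem' r := by
    refine ⟨fun σ => AlgEquiv.commutes _ r, 0, fun d hd => ?_⟩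
    rw [MvPowerSeries.algebraMap_apply, MvPowerSeries.coeff_C, if_neg]
    rintro rfl
    simp at hd

theorem coeff_embDomain_of_mem {K : Type*} [Field K] {f : MvPowerSeries ℕ K} (hf : f ∈ Sym K)
    (σ : Equiv.Perm ℕ) (d : ℕ →₀ ℕ) :
    MvPowerSeries.coeff (d.embDomain σ.toEmbedding) f = MvPowerSeries.coeff d f := by
  conv_lhs => rw [← hf.1 σ]
  exact MvPowerSeries.coeff_embDomain_rename σ.toEmbedding f d

theorem mem_of_coeff {K : Type*} [Field K] {f : MvPowerSeries ℕ K} (N : ℕ)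
    (h : ∀ (σ : Equiv.Perm ℕ) (d : ℕ →₀ ℕ),
      MvPowerSeries.coeff (d.embDomain σ.toEmbedding) f = MvPowerSeries.coeff d f)
    (hN : ∀ d : ℕ →₀ ℕ, N < d.degree → MvPowerSeries.coeff d f = 0) : f ∈ Sym K := by
  refine ⟨fun σ => ?_, N, hN⟩
  ext d
  have hd : d = (d.embDomain σ.symm.toEmbedding).embDomain σ.toEmbedding := by
    rw [Finsupp.embDomain_eq_mapDomain, Finsupp.embDomain_eq_mapDomain, ← Finsupp.mapDomain_comp]
    simp
  conv_lhs => rw [hd]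
  rw [← h σ.symm d]
  exact MvPowerSeries.coeff_embDomain_rename σ.toEmbedding f _

/-- The formal power series whose coefficient of `x^d` is `c d`. -/
def series {K : Type*} [Field K] (c : (ℕ →₀ ℕ) → K) : MvPowerSeries ℕ K := c

theorem coeff_series {K : Type*} [Field K] (c : (ℕ →₀ ℕ) → K) (d : ℕ →₀ ℕ) :
    MvPowerSeries.coeff d (series c) = c d := rfl

/-- The monomial symmetric function `m_μ`: the sum of all monomials `x^d` whose multiset of nonzero
exponents is the multiset of parts of `μ`. -/
def m (K : Type*) [Field K] {n : ℕ} (μ : n.Partition) : Sym K :=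
  ⟨series fun d => if exponents d = μ.parts then 1 else 0, mem_of_coeff n
    (fun σ d => by simp only [coeff_series, exponents_embDomain])
    (fun d hd => by
      rw [coeff_series, if_neg]
      intro h
      rw [← sum_exponents, h, μ.parts_sum] at hd
      exact lt_irrefl _ hd)⟩

/-- The elementary symmetric function `e_n`: the sum of all squarefree monomials of degree `n`. -/
def e (K : Type*) [Field K] (n : ℕ) : Sym K :=
  ⟨series fun d => if d.degree = n ∧ ∀ a ∈ exponents d, a = 1 then 1 else 0, mem_of_coeff n
    (fun σ d => by simp only [coeff_series, exponents_embDomain, degree_embDomain])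
    (fun d hd => by rw [coeff_series, if_neg]; rintro ⟨h, -⟩; omega)⟩

/-- The complete homogeneous symmetric function `h_n`: the sum of all monomials of degree `n`. -/
def h (K : Type*) [Field K] (n : ℕ) : Sym K :=
  ⟨series fun d => if d.degree = n then 1 else 0, mem_of_coeff n
    (fun σ d => by simp only [coeff_series, degree_embDomain])
    (fun d hd => by rw [coeff_series, if_neg]; omega)⟩

open Classical in
/-- The power sum `p_n = x_0 ^ n + x_1 ^ n + ⋯` for `n ≥ 1`. -/
def p (K : Type*) [Field K] (n : ℕ) : Sym K :=
  ⟨series fun d => if ∃ i, d = Finsupp.single i n then 1 else 0, mem_of_coeff n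
    (fun σ d => by
      simp only [coeff_series]
      refine if_congr ⟨?_, ?_⟩ rfl rfl
      · rintro ⟨i, hi⟩
        refine ⟨σ.symm i, Finsupp.embDomain_injective σ.toEmbedding ?_⟩
        rw [hi, Finsupp.embDomain_single]; simp
      · rintro ⟨i, rfl⟩
        exact ⟨σ i, by rw [Finsupp.embDomain_single]; rfl⟩)
    (fun d hd => by
      rw [coeff_series, if_neg]
      rintro ⟨i, rfl⟩
      rw [Finsupp.degree_single] at hd
      exact lt_irrefl _ hd)⟩

/-! ### `Λ` is the polynomial ring in the power sums, over a field of characteristic zero -/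

theorem coeff_p {K : Type*} [Field K] (n : ℕ) (d : ℕ →₀ ℕ) [Decidable (∃ i, d = Finsupp.single i n)] :
    MvPowerSeries.coeff d (p K n : MvPowerSeries ℕ K) =
      if ∃ i, d = Finsupp.single i n then 1 else 0 := by
  rw [p, coeff_series]
  congr

open MvPolynomial in
theorem esymm_mem {K : Type*} [Field K] [CharZero K] (n k : ℕ) :
    esymm (Fin n) K k ∈ Algebra.adjoin K (Set.range fun i : Fin n => psum (Fin n) K (i + 1)) := by
  set S := Algebra.adjoin K (Set.range fun i : Fin n => psum (Fin n) K (i + 1))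
  induction k using Nat.strong_induction_on with
  | _ k ih =>
    rcases Nat.eq_zero_or_pos k with rfl | hk
    · simp
    by_cases hkn : n < k
    · have : esymm (Fin n) K k = 0 := by
        rw [esymm, Finset.powersetCard_eq_empty.2 (by simpa using hkn), Finset.sum_empty]
      rw [this]; exact zero_mem _
    have hp : ∀ j, 0 < j → j ≤ k → psum (Fin n) K j ∈ S := fun j h0 hj =>
      Algebra.subset_adjoin ⟨⟨j - 1, by omega⟩, by simp [Nat.sub_add_cancel h0]⟩
    have h := mul_esymm_eq_sum (Fin n) K k
    have h2 : (k : MvPolynomial (Fin n) K) * esymm (Fin n) K k ∈ S := by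
      rw [h]
      refine S.mul_mem (S.pow_mem (S.neg_mem S.one_mem) _) (S.sum_mem fun a ha => ?_)
      obtain ⟨ha1, ha2⟩ := Finset.mem_filter.1 ha
      have ha1 := Finset.HasAntidiagonal.mem_antidiagonal.1 ha1
      exact S.mul_mem (S.mul_mem (S.pow_mem (S.neg_mem S.one_mem) _) (ih _ ha2))
        (hp _ (by omega) (by omega))
    have h3 : esymm (Fin n) K k = (k : K)⁻¹ • ((k : MvPolynomial (Fin n) K) * esymm (Fin n) K k) := by
      have hk' : (k : K) ≠ 0 := by exact_mod_cast hk.ne'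
      rw [show (k : MvPolynomial (Fin n) K) = C (k : K) by simp, C_mul', smul_smul,
        inv_mul_cancel₀ hk', one_smul]
    rw [h3]
    exact S.smul_mem h2 _

open MvPolynomial in
theorem sym_mem {K : Type*} [Field K] [CharZero K] (n : ℕ) (f : MvPolynomial (Fin n) K)
    (hf : f.IsSymmetric) :
    ∃ P : MvPolynomial (Fin n) K, aeval (fun i : Fin n => psum (Fin n) K (i + 1)) P = f := by
  obtain ⟨Q, hQ⟩ := (esymmAlgHom_fin_bijective K n).2 ⟨f, hf⟩
  have h1 := esymmAlgHom_apply (σ := Fin n) (R := K) Q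
  rw [hQ] at h1
  have : f ∈ Algebra.adjoin K (Set.range fun i : Fin n => psum (Fin n) K (i + 1)) := by
    change f = _ at h1
    rw [h1]
    exact (Algebra.adjoin_le (by rintro _ ⟨i, rfl⟩; exact esymm_mem n _) :
      Algebra.adjoin K (Set.range fun i : Fin n => esymm (Fin n) K (i + 1)) ≤ _)
      (by rw [Algebra.adjoin_range_eq_range_aeval]; exact ⟨Q, rfl⟩)
  rw [Algebra.adjoin_range_eq_range_aeval] at this
  exact this

open MvPolynomial in
theorem psum_indep {K : Type*} [Field K] [CharZero K] (n : ℕ) :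
    AlgebraicIndependent K (fun i : Fin n => psum (Fin n) K (i + 1)) := by
  let x : Fin n → symmetricSubalgebra (Fin n) K :=
    fun i => ⟨psum (Fin n) K (i + 1), psum_isSymmetric _ _ _⟩
  have hx : Algebra.adjoin K (Set.range x) = ⊤ := by
    rw [Algebra.adjoin_range_eq_range_aeval, eq_top_iff]
    rintro ⟨f, hf⟩ -
    obtain ⟨P, hP⟩ := sym_mem n f hf
    refine ⟨P, Subtype.ext ?_⟩
    change _ = f
    rw [← hP]
    exact (Subalgebra.mvPolynomial_aeval_coe _ _ _).symm
  have : Algebra.IsAlgebraic (Algebra.adjoin K (Set.range x)) (symmetricSubalgebra (Fin n) K) := by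
    rw [hx]
    exact ⟨fun a => isAlgebraic_algebraMap (⟨a, trivial⟩ : (⊤ : Subalgebra K _))⟩
  have htr : Algebra.trdeg K (symmetricSubalgebra (Fin n) K) = n := by
    rw [← (esymmAlgEquiv (Fin n) K (Fintype.card_fin n)).trdeg_eq]
    simp
  have hb := Algebra.IsAlgebraic.isTranscendenceBasis_of_lift_le_trdeg_of_finite K x (by simp [htr])
  exact hb.1.map' (f := (symmetricSubalgebra (Fin n) K).val) Subtype.val_injective

theorem killCompl_p {K : Type*} [Field K] (n k : ℕ) :
    MvPowerSeries.killCompl Fin.valEmbedding (p K (k + 1) : MvPowerSeries ℕ K) =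
      (MvPolynomial.psum (Fin n) K (k + 1) : MvPowerSeries (Fin n) K) := by
  classical
  ext d
  rw [MvPowerSeries.coeff_killCompl, coeff_p, MvPolynomial.coeff_coe, MvPolynomial.psum,
    MvPolynomial.coeff_sum]
  simp only [MvPolynomial.coeff_X_pow]
  by_cases hd : ∃ i : Fin n, d = Finsupp.single i (k + 1)
  · obtain ⟨i, rfl⟩ := hd
    rw [if_pos ⟨i, by rw [Finsupp.embDomain_single]; rfl⟩, Finset.sum_eq_single i]
    · simp
    · intro j _ hj
      rw [if_neg]
      intro h
      exact hj ((Finsupp.single_left_inj (Nat.succ_ne_zero k)).1 h)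
    · simp
  · rw [if_neg, Finset.sum_eq_zero]
    · intro i _
      rw [if_neg]
      exact fun h => hd ⟨i, h.symm⟩
    · rintro ⟨i, hi⟩
      have hmem : i ∈ (d.embDomain Fin.valEmbedding).support := by rw [hi]; simp
      rw [Finsupp.support_embDomain, Finset.mem_map] at hmem
      obtain ⟨j, -, rfl⟩ := hmem
      refine hd ⟨j, Finsupp.embDomain_injective Fin.valEmbedding ?_⟩
      rw [hi, Finsupp.embDomain_single]

/-- Evaluation of a polynomial at the power sums; the variable `X k` goes to `p_{k+1}`. -/
def evalPowerSums (K : Type*) [Field K] : MvPolynomial ℕ K →ₐ[K] Sym K :=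
  MvPolynomial.aeval fun k => p K (k + 1)

theorem killCompl_evalPowerSums {K : Type*} [Field K] (n : ℕ) (Q : MvPolynomial (Fin n) K) :
    MvPowerSeries.killCompl Fin.valEmbedding
      (evalPowerSums K (MvPolynomial.rename Fin.val Q) : MvPowerSeries ℕ K) =
      ((MvPolynomial.aeval (fun i : Fin n => MvPolynomial.psum (Fin n) K (i + 1)) Q :
        MvPolynomial (Fin n) K) : MvPowerSeries (Fin n) K) := by
  have : (((MvPowerSeries.killCompl (R := K) (Fin.valEmbedding (n := n))).comp (Sym K).val).comp
      (evalPowerSums K)).comp (MvPolynomial.rename Fin.val) =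
      (MvPolynomial.coeToMvPowerSeries.algHom K).comp
        (MvPolynomial.aeval (fun i : Fin n => MvPolynomial.psum (Fin n) K (i + 1))) := by
    ext1 i
    simp [evalPowerSums, killCompl_p, MvPolynomial.coeToMvPowerSeries.algHom_apply]
  simpa [MvPolynomial.coeToMvPowerSeries.algHom_apply] using DFunLike.congr_fun this Q

theorem evalPowerSums_injective (K : Type*) [Field K] [CharZero K] :
    Function.Injective (evalPowerSums K) := by
  rw [injective_iff_map_eq_zero]
  intro P hP
  obtain ⟨n, f, -, q, rfl⟩ := MvPolynomial.exists_fin_rename P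
  obtain ⟨N, hN⟩ : ∃ N, ∀ i, f i < N :=
    ⟨Finset.univ.sup f + 1, fun i => Nat.lt_succ_of_le (Finset.le_sup (Finset.mem_univ i))⟩
  let g : Fin n → Fin N := fun i => ⟨f i, hN i⟩
  have hg : MvPolynomial.rename f q = MvPolynomial.rename Fin.val (MvPolynomial.rename g q) := by
    rw [MvPolynomial.rename_rename]; rfl
  rw [hg] at hP ⊢
  have h1 := killCompl_evalPowerSums N (MvPolynomial.rename g q)
  rw [hP] at h1
  have h2 : MvPolynomial.aeval (fun i : Fin N => MvPolynomial.psum (Fin N) K (i + 1))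
      (MvPolynomial.rename g q) = 0 := by
    apply MvPolynomial.coe_injective
    rw [← h1]; simp
  rw [(injective_iff_map_eq_zero _).1 (psum_indep N) _ h2, map_zero]

/-- The degree of `∏ p_{k+1} ^ (u k)`. -/
def weight (u : ℕ →₀ ℕ) : ℕ := u.sum fun k a => a * (k + 1)

theorem degree_of_coeff_ne_zero {K : Type*} [Field K] (u : ℕ →₀ ℕ) (c : K) (d : ℕ →₀ ℕ)
    (hd : MvPowerSeries.coeff d
      (evalPowerSums K (MvPolynomial.monomial u c) : MvPowerSeries ℕ K) ≠ 0) :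
    d.degree = weight u := by
  have hmul : ∀ (f g : MvPowerSeries ℕ K) (v w : ℕ),
      (∀ d, MvPowerSeries.coeff d f ≠ 0 → d.degree = v) →
      (∀ d, MvPowerSeries.coeff d g ≠ 0 → d.degree = w) →
      ∀ d, MvPowerSeries.coeff d (f * g) ≠ 0 → d.degree = v + w := by
    intro f g v w hf hg d hd
    rw [MvPowerSeries.coeff_mul] at hd
    obtain ⟨a, ha, hne⟩ := Finset.exists_ne_zero_of_sum_ne_zero hd
    rw [← Finset.HasAntidiagonal.mem_antidiagonal.1 ha, map_add, hf _ (left_ne_zero_of_mul hne),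
      hg _ (right_ne_zero_of_mul hne)]
  have hone : ∀ d, MvPowerSeries.coeff d (1 : MvPowerSeries ℕ K) ≠ 0 → d.degree = 0 := by
    intro d hd
    rw [MvPowerSeries.coeff_one] at hd
    have : d = 0 := by by_contra h0; exact hd (if_neg h0)
    rw [this, map_zero]
  have hp : ∀ k d, MvPowerSeries.coeff d (p K (k + 1) : MvPowerSeries ℕ K) ≠ 0 →
      d.degree = k + 1 := by
    intro k d hd
    classical
    rw [coeff_p] at hd
    have : ∃ i, d = Finsupp.single i (k + 1) := by by_contra h0; exact hd (if_neg h0)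
    obtain ⟨i, rfl⟩ := this
    rw [Finsupp.degree_single]
  have hpow : ∀ k a d, MvPowerSeries.coeff d ((p K (k + 1) : MvPowerSeries ℕ K) ^ a) ≠ 0 →
      d.degree = a * (k + 1) := by
    intro k a
    induction a with
    | zero => simpa using hone
    | succ a ih =>
      intro d hd
      rw [pow_succ] at hd
      rw [hmul _ _ _ _ ih (hp k) d hd, Nat.succ_mul]
  have hprod : ∀ (s : Finset ℕ) d, MvPowerSeries.coeff d
      (∏ k ∈ s, (p K (k + 1) : MvPowerSeries ℕ K) ^ u k) ≠ 0 →
      d.degree = ∑ k ∈ s, u k * (k + 1) := by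
    intro s
    induction s using Finset.induction_on with
    | empty => simpa using hone
    | insert k s hk ih =>
      intro d hd
      rw [Finset.prod_insert hk] at hd
      rw [Finset.sum_insert hk, hmul _ _ _ _ (hpow k (u k)) ih d hd]
  have hval : (evalPowerSums K (MvPolynomial.monomial u c) : MvPowerSeries ℕ K) =
      c • ∏ k ∈ u.support, (p K (k + 1) : MvPowerSeries ℕ K) ^ u k := by
    rw [evalPowerSums, MvPolynomial.aeval_monomial, ← Algebra.smul_def, Finsupp.prod]
    simp
  rw [hval, map_smul, smul_eq_mul] at hd
  exact hprod _ d (right_ne_zero_of_mul hd)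

theorem evalPowerSums_surjective (K : Type*) [Field K] [CharZero K] :
    Function.Surjective (evalPowerSums K) := by
  classical
  rintro ⟨f, hf⟩
  obtain ⟨N, hN⟩ := hf.2
  -- restriction of `f` to `N` variables is a symmetric polynomial
  obtain ⟨F, hF⟩ : ∃ F : MvPolynomial (Fin N) K,
      (F : MvPowerSeries (Fin N) K) = MvPowerSeries.killCompl Fin.valEmbedding f := by
    refine ⟨MvPowerSeries.truncTotal (N + 1) (MvPowerSeries.killCompl Fin.valEmbedding f), ?_⟩
    ext d
    rw [MvPolynomial.coeff_coe, MvPowerSeries.coeff_truncTotal_eq_ite]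
    split_ifs with hd
    · rfl
    · rw [MvPowerSeries.coeff_killCompl, hN]
      rw [← sum_exponents, exponents, Finsupp.support_embDomain]
      have : d.degree = (d.support.val.map fun x => d x).sum := rfl
      simp only [Finset.map_val, Multiset.map_map, Function.comp_def, Finsupp.embDomain_apply_self]
      omega
  have hcoeff : ∀ d : Fin N →₀ ℕ,
      F.coeff d = MvPowerSeries.coeff (d.embDomain Fin.valEmbedding) f := by
    intro d
    rw [← MvPowerSeries.coeff_killCompl, ← hF, MvPolynomial.coeff_coe]
  have hsym : F.IsSymmetric := by
    intro τ
    ext d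
    obtain ⟨d, rfl⟩ : ∃ d', d = Finsupp.mapDomain τ d' :=
      ⟨Finsupp.mapDomain τ.symm d, by rw [← Finsupp.mapDomain_comp]; simp⟩
    rw [MvPolynomial.coeff_rename_mapDomain _ τ.injective, hcoeff, hcoeff,
      ← coeff_embDomain_of_mem hf (τ.viaEmbedding Fin.valEmbedding)]
    congr 1
    simp only [Finsupp.embDomain_eq_mapDomain, ← Finsupp.mapDomain_comp]
    congr 1
    congr 1
    ext i
    exact (Equiv.Perm.viaEmbedding_apply τ Fin.valEmbedding i)
  obtain ⟨Q, hQ⟩ := sym_mem N F hsym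
  set P := MvPolynomial.rename Fin.val Q with hPdef
  have hPF : ∀ d : Fin N →₀ ℕ, MvPowerSeries.coeff (d.embDomain Fin.valEmbedding)
      (evalPowerSums K P : MvPowerSeries ℕ K) =
      MvPowerSeries.coeff (d.embDomain Fin.valEmbedding) f := by
    intro d
    rw [← MvPowerSeries.coeff_killCompl, ← MvPowerSeries.coeff_killCompl,
      killCompl_evalPowerSums, hQ, hF]
  refine ⟨∑ u ∈ P.support with weight u ≤ N, MvPolynomial.monomial u (P.coeff u), Subtype.ext ?_⟩
  have hsum : ∀ (s : Finset (ℕ →₀ ℕ)) (d : ℕ →₀ ℕ), MvPowerSeries.coeff d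
      (evalPowerSums K (∑ u ∈ s, MvPolynomial.monomial u (P.coeff u)) : MvPowerSeries ℕ K) =
      ∑ u ∈ s, MvPowerSeries.coeff d
        (evalPowerSums K (MvPolynomial.monomial u (P.coeff u)) : MvPowerSeries ℕ K) := by
    intro s d
    simp
  ext d
  rw [hsum]
  change _ = MvPowerSeries.coeff d f
  rcases lt_or_ge N d.degree with hd | hd
  · rw [hN d hd]
    refine Finset.sum_eq_zero fun u hu => ?_
    by_contra h0
    have := degree_of_coeff_ne_zero _ _ _ h0
    have := (Finset.mem_filter.1 hu).2
    omega
  · have h1 : ∑ u ∈ P.support with weight u ≤ N, MvPowerSeries.coeff d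
        (evalPowerSums K (MvPolynomial.monomial u (P.coeff u)) : MvPowerSeries ℕ K) =
        MvPowerSeries.coeff d (evalPowerSums K P : MvPowerSeries ℕ K) := by
      conv_rhs => rw [MvPolynomial.as_sum P]
      rw [hsum]
      refine Finset.sum_subset (Finset.filter_subset _ _) fun u hu hu' => ?_
      by_contra h0
      have := degree_of_coeff_ne_zero _ _ _ h0
      exact hu' (Finset.mem_filter.2 ⟨hu, by omega⟩)
    rw [h1]
    -- move the support of `d` into the first `N` variables
    have hcard : d.support.card ≤ N := by
      refine le_trans ?_ hd
      rw [Finsupp.degree_apply, Finset.card_eq_sum_ones]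
      exact Finset.sum_le_sum fun i hi => Nat.one_le_iff_ne_zero.2 (Finsupp.mem_support_iff.1 hi)
    obtain ⟨σ, hσ⟩ : ∃ σ : Equiv.Perm ℕ, ∀ i ∈ d.support, σ i < N := by
      have := Equiv.Perm.isMultiplyPretransitive ℕ d.support.card
      obtain ⟨σ, hσ⟩ := MulAction.exists_smul_eq (Equiv.Perm ℕ)
        (d.support.equivFin.symm.toEmbedding.trans (Function.Embedding.subtype _))
        (Fin.valEmbedding : Fin d.support.card ↪ ℕ)
      refine ⟨σ, fun i hi => ?_⟩
      have h1 := DFunLike.congr_fun hσ (d.support.equivFin ⟨i, hi⟩)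
      have h2 : σ i = (d.support.equivFin ⟨i, hi⟩ : ℕ) := by simpa using h1
      rw [h2]
      exact lt_of_lt_of_le (Fin.is_lt _) hcard
    obtain ⟨d', hd'⟩ : ∃ d' : Fin N →₀ ℕ,
        d.embDomain σ.toEmbedding = d'.embDomain Fin.valEmbedding := by
      have : d.embDomain σ.toEmbedding ∈ Set.range (Finsupp.embDomain (M := ℕ) (Fin.valEmbedding (n := N))) := by
        rw [Finsupp.mem_range_embDomain_iff]
        intro j hj
        rw [Finset.mem_coe, Finsupp.support_embDomain, Finset.mem_map] at hj
        obtain ⟨i, hi, rfl⟩ := hj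
        exact ⟨⟨σ i, hσ i hi⟩, rfl⟩
      obtain ⟨d', h⟩ := this
      exact ⟨d', h.symm⟩
    rw [← coeff_embDomain_of_mem hf σ d, ← coeff_embDomain_of_mem (evalPowerSums K P).2 σ d, hd',
      hPF]

/-- The isomorphism between `K[y_0, y_1, …]` and `Λ` that sends `y_k` to `p_{k+1}`. -/
def powerSumEquiv (K : Type*) [Field K] [CharZero K] : MvPolynomial ℕ K ≃ₐ[K] Sym K :=
  AlgEquiv.ofBijective (evalPowerSums K) ⟨evalPowerSums_injective K, evalPowerSums_surjective K⟩

/-- Plethystic substitution: the unique `K`-algebra homomorphism from `Λ` to `A` that sends the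
power sum `p_n` to `g n` for all `n ≥ 1`. -/
def plethysm {K : Type*} [Field K] [CharZero K] {A : Type*} [CommRing A] [Algebra K A]
    (g : ℕ → A) : Sym K →ₐ[K] A :=
  (MvPolynomial.aeval fun k => g (k + 1)).comp (powerSumEquiv K).symm.toAlgHom

theorem plethysm_p {K : Type*} [Field K] [CharZero K] {A : Type*} [CommRing A] [Algebra K A]
    (g : ℕ → A) (n : ℕ) (hn : 1 ≤ n) : plethysm g (p K n) = g n := by
  obtain ⟨k, rfl⟩ := Nat.exists_eq_add_of_le' hn
  have : (powerSumEquiv K).symm (p K (k + 1)) = MvPolynomial.X k := by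
    rw [AlgEquiv.symm_apply_eq]
    simp [powerSumEquiv, evalPowerSums]
  simp [plethysm, this]

/-- The substitution `f ↦ f[X - (1 - 1/q)/z]`, with values in the Laurent series in `z` over `Λ`:
since `q` and `z` are monomials for plethysm, `p_n` goes to `p_n - (1 - q⁻ⁿ) z⁻ⁿ`. -/
def shift {K : Type*} [Field K] [CharZero K] (q : K) : Sym K →ₐ[K] LaurentSeries (Sym K) :=
  plethysm fun n => HahnSeries.C (p K n) -
    HahnSeries.single (-(n : ℤ)) (algebraMap K (Sym K) (1 - q⁻¹ ^ n))

/-- `Ω[zX] = ∑ h_n zⁿ`, as a Laurent series in `z` over `Λ`. -/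
def omega (K : Type*) [Field K] : LaurentSeries (Sym K) :=
  HahnSeries.ofPowerSeries ℤ (Sym K) (PowerSeries.mk fun n => h K n)

/-- The creation operator `C_a f = (-1/q)^(a-1) f[X - (1 - 1/q)/z] Ω[zX] |_{z^a}`. -/
def creation {K : Type*} [Field K] [CharZero K] (q : K) (a : ℤ) (f : Sym K) : Sym K :=
  (-1 / q) ^ (a - 1) • (shift q f * omega K).coeff a

/-- `C_α = C_{α_1} C_{α_2} ⋯ C_{α_r}(1)` for a composition `α = (α_1, …, α_r)`. -/
def creationComp {K : Type*} [Field K] [CharZero K] (q : K) {n : ℕ} (α : Composition n) : Sym K :=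
  α.blocks.foldr (fun a f => creation q (a : ℤ) f) 1

/-- The partition `2^k 1^l`. -/
def twoColumn (k l : ℕ) : Nat.Partition (2 * k + l) where
  parts := Multiset.replicate k 2 + Multiset.replicate l 1
  parts_pos := by
    intro i hi
    rcases Multiset.mem_add.1 hi with hi | hi <;> rw [Multiset.eq_of_mem_replicate hi] <;> norm_num
  parts_sum := by simp [mul_comm]

/-- The field `ℚ(q, t)` of rational functions in two variables. -/
abbrev Qqt : Type := FractionRing (MvPolynomial (Fin 2) ℚ)

/-- The element `q` of `ℚ(q, t)`. -/
def q : Qqt := algebraMap (MvPolynomial (Fin 2) ℚ) Qqt (MvPolynomial.X 0)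

end SymFn

end

/-! For a series φ with constant term 1, put F(s) = ∏ φ(s x_i). The substitution X ↦ X - (1-1/q)/z
multiplies F by φ(s/(qz))/φ(s/z). Hence, if c(-s)φ(s) is a monomial κ s^k, the rational factors
cancel and c(-s/(qz)) F[X-(1-1/q)/z] = q^{-k} c(-s/z) F. Multiplying by Ω[zX] and extracting s^n z^0
turns a weighted sum of creation operators on the parts of F into a plain sum of products with the
h_r (`sum_creation_multSeries`).

Take φ = (1+as)(1+bs) with a+b = 1 and u = -ab. Then F generates u^k (-1)^k m_{2^k 1^l}, and the
weight is c = u s^2/(1-s-us^2), whose coefficients are the binomials of the recurrence. Partial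
fractions and E(s)H(-s) = 1 evaluate the remaining sum as a multiple of e_n
(`multSeries_quadratic_add_sum`). The identity holds for infinitely many u, so the powers of u may
be compared, which is `signedTwoColumn_recurrence`.

The choice φ = 1+s, c = s/(1-s) gives e_n = ∑ C_r e_{n-r} over r ≥ 1. Both recurrences have
coefficients in ℕ[q], and C_r prepends the part r to a composition, so induction gives positivity.
-/

noncomputable section

namespace SymFn

open PowerSeries Finset

/-! ### Infinite products ∏ φ(s x_i) and their multiplicativity. -/

/-- The degree `n` part of the infinite product `∏ φ(x_i)`, for a power series `φ` with constant
coefficient `1`. -/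
def multSeries {K : Type*} [Field K] (φ : PowerSeries K) (n : ℕ) : Sym K :=
  ⟨series fun d => if d.degree = n then ((exponents d).map fun a => coeff a φ).prod else 0,
    mem_of_coeff n
      (fun σ d => by simp only [coeff_series, exponents_embDomain, degree_embDomain])
      (fun d hd => by rw [coeff_series, if_neg]; omega)⟩

theorem coeff_multSeries {K : Type*} [Field K] (φ : PowerSeries K) (n : ℕ) (d : ℕ →₀ ℕ) :
    MvPowerSeries.coeff d (multSeries φ n : MvPowerSeries ℕ K) =
      if d.degree = n then ∏ i ∈ d.support, coeff (d i) φ else 0 := by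
  rw [multSeries, coeff_series, exponents, Multiset.map_map]
  rfl

/-- The infinite product `∏ φ(s x_i)`, graded by powers of `s`. -/
def multGen {K : Type*} [Field K] (φ : PowerSeries K) : PowerSeries (Sym K) :=
  PowerSeries.mk (multSeries φ)

/-- Splitting the exponent vector `d` amounts to splitting each `d i` independently, so this is
distributivity in the form `Finset.prod_sum`. -/
theorem sum_antidiagonal_prod {R : Type*} [CommSemiring R] (f g : ℕ → R) (d : ℕ →₀ ℕ) :
    ∑ x ∈ antidiagonal d, ∏ i ∈ d.support, f (x.1 i) * g (x.2 i) =
      ∏ i ∈ d.support, ∑ y ∈ antidiagonal (d i), f y.1 * g y.2 := by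
  classical
  rw [Finset.prod_sum]
  refine Finset.sum_bij' (fun x _ i _ => (x.1 i, x.2 i))
    (fun p _ => (Finsupp.onFinset d.support (fun i => if h : i ∈ d.support then (p i h).1 else 0)
        (by intro i hi; by_contra h; simp [h] at hi),
      Finsupp.onFinset d.support (fun i => if h : i ∈ d.support then (p i h).2 else 0)
        (by intro i hi; by_contra h; simp [h] at hi))) ?_ ?_ ?_ ?_ ?_
  · intro x hx
    rw [Finset.mem_pi]
    intro i _
    rw [HasAntidiagonal.mem_antidiagonal] at hx ⊢
    rw [← hx]; rfl
  · intro p hp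
    rw [Finset.mem_pi] at hp
    rw [HasAntidiagonal.mem_antidiagonal]
    ext i
    by_cases h : i ∈ d.support
    · have := HasAntidiagonal.mem_antidiagonal.1 (hp i h)
      simp [Finsupp.mem_support_iff.1 h, this]
    · simp [Finsupp.notMem_support_iff.1 h]
  · intro x hx
    rw [HasAntidiagonal.mem_antidiagonal] at hx
    have h0 : ∀ i, d i = 0 → x.1 i = 0 ∧ x.2 i = 0 := by
      intro i hi
      rw [← hx, Finsupp.add_apply] at hi
      omega
    ext i
    · by_cases h : d i = 0
      · simp [h, (h0 i h).1]
      · simp [h]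
    · by_cases h : d i = 0
      · simp [h, (h0 i h).2]
      · simp [h]
  · intro p hp
    funext i hi
    simp [Finsupp.mem_support_iff.1 hi]
  · intro x hx
    exact (Finset.prod_attach d.support fun i => f (x.1 i) * g (x.2 i)).symm

theorem coeff_antidiagonal_sum {K : Type*} [Field K] (f g : ℕ → Sym K) (n : ℕ) (d : ℕ →₀ ℕ) :
    MvPowerSeries.coeff d
      ((∑ y ∈ antidiagonal n, f y.1 * g y.2 : Sym K) : MvPowerSeries ℕ K) =
      ∑ x ∈ antidiagonal d, ∑ y ∈ antidiagonal n,
        MvPowerSeries.coeff x.1 (f y.1 : MvPowerSeries ℕ K) *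
          MvPowerSeries.coeff x.2 (g y.2 : MvPowerSeries ℕ K) := by
  rw [Finset.sum_comm]
  simp [MvPowerSeries.coeff_mul]

theorem multGen_mul {K : Type*} [Field K] {φ ψ : PowerSeries K} (hφ : coeff 0 φ = 1)
    (hψ : coeff 0 ψ = 1) : multGen (φ * ψ) = multGen φ * multGen ψ := by
  classical
  refine PowerSeries.ext fun n => ?_
  rw [coeff_mul]
  simp only [multGen, coeff_mk]
  apply Subtype.ext
  ext d
  rw [coeff_antidiagonal_sum, coeff_multSeries]
  have key : ∀ x ∈ antidiagonal d, ∑ y ∈ antidiagonal n,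
        MvPowerSeries.coeff x.1 (multSeries φ y.1 : MvPowerSeries ℕ K) *
          MvPowerSeries.coeff x.2 (multSeries ψ y.2 : MvPowerSeries ℕ K) =
      if d.degree = n then ∏ i ∈ d.support, coeff (x.1 i) φ * coeff (x.2 i) ψ else 0 := by
    intro x hx
    rw [HasAntidiagonal.mem_antidiagonal] at hx
    have hdeg : x.1.degree + x.2.degree = d.degree := by rw [← hx, map_add]
    simp only [coeff_multSeries]
    -- Constant term 1 means that variables absent from a factor contribute 1, so all products can
    -- run over the support of `d`.
    have hs : ∀ (c : ℕ →₀ ℕ) (χ : PowerSeries K), coeff 0 χ = 1 → c.support ⊆ d.support →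
        ∏ i ∈ c.support, coeff (c i) χ = ∏ i ∈ d.support, coeff (c i) χ := by
      intro c χ hχ hc
      refine Finset.prod_subset hc fun i _ hi => ?_
      rw [Finsupp.notMem_support_iff.1 hi, hχ]
    have h1 : x.1.support ⊆ d.support := by
      rw [← hx]; intro i; simp; omega
    have h2 : x.2.support ⊆ d.support := by
      rw [← hx]; intro i; simp; omega
    rw [Finset.prod_mul_distrib, ← hs _ _ hφ h1, ← hs _ _ hψ h2]
    split_ifs with hn
    -- The two degrees of the split single out one pair of homogeneous parts.
    · rw [Finset.sum_eq_single (x.1.degree, x.2.degree)]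
      · simp
      · rintro ⟨a, b⟩ _ hne
        by_cases ha : x.1.degree = a
        · by_cases hb : x.2.degree = b
          · subst ha hb; exact absurd rfl hne
          · simp [hb]
        · simp [ha]
      · intro hnot
        exact absurd (HasAntidiagonal.mem_antidiagonal.2 (by simpa [hn] using hdeg)) hnot
    · refine Finset.sum_eq_zero fun y hy => ?_
      rw [HasAntidiagonal.mem_antidiagonal] at hy
      by_cases ha : x.1.degree = y.1
      · rw [if_neg (show ¬ x.2.degree = y.2 by omega), mul_zero]
      · rw [if_neg ha, zero_mul]
  rw [Finset.sum_congr rfl key]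
  split_ifs with hn
  · rw [sum_antidiagonal_prod (fun a => coeff a φ) (fun a => coeff a ψ)]
    simp only [coeff_mul]
  · simp

theorem degree_eq_sum (d : ℕ →₀ ℕ) : d.degree = ∑ i ∈ d.support, d i := rfl

theorem multSeries_one_add {K : Type*} [Field K] (c : K) (n : ℕ) :
    multSeries (1 + C c * X) n = c ^ n • e K n := by
  apply Subtype.ext
  ext d
  rw [coeff_multSeries, Subalgebra.coe_smul, MvPowerSeries.coeff_smul, e, coeff_series]
  by_cases hn : d.degree = n
  · rw [if_pos hn]
    by_cases h1 : ∀ a ∈ exponents d, a = 1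
    · have h1' : ∀ i ∈ d.support, d i = 1 := fun i hi => h1 _ (Multiset.mem_map_of_mem _ hi)
      rw [if_pos ⟨hn, h1⟩, ← hn, degree_eq_sum, ← Finset.prod_pow_eq_pow_sum, mul_one]
      refine Finset.prod_congr rfl fun i hi => ?_
      rw [h1' i hi]
      simp [coeff_one]
    · rw [if_neg (fun h => h1 h.2), mul_zero]
      push Not at h1
      obtain ⟨a, ha, ha1⟩ := h1
      obtain ⟨i, hi, rfl⟩ := Multiset.mem_map.1 ha
      refine Finset.prod_eq_zero (i := i) hi ?_
      have h0 : d i ≠ 0 := Finsupp.mem_support_iff.1 hi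
      simp [coeff_one, coeff_X, h0, ha1]
  · rw [if_neg hn, if_neg (fun h => hn h.1), mul_zero]

theorem multSeries_geom {K : Type*} [Field K] (c : K) (n : ℕ) :
    multSeries (PowerSeries.mk fun i => c ^ i) n = c ^ n • h K n := by
  apply Subtype.ext
  ext d
  rw [coeff_multSeries, Subalgebra.coe_smul, MvPowerSeries.coeff_smul, h, coeff_series]
  split_ifs with hn
  · simp only [coeff_mk]
    rw [Finset.prod_pow_eq_pow_sum, ← degree_eq_sum, hn, mul_one]
  · rw [mul_zero]

theorem multGen_one {K : Type*} [Field K] : multGen (1 : PowerSeries K) = 1 := by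
  refine PowerSeries.ext fun n => ?_
  have := multSeries_one_add (0 : K) n
  rw [map_zero, zero_mul, add_zero] at this
  rw [multGen, coeff_mk, this, coeff_one]
  split_ifs with hn
  · subst hn
    rw [pow_zero, one_smul]
    apply Subtype.ext
    ext d
    change _ = MvPowerSeries.coeff d 1
    classical
    rw [e, coeff_series, MvPowerSeries.coeff_one]
    refine if_congr ⟨fun h => ?_, fun h => ?_⟩ rfl rfl
    · exact (Finsupp.degree_eq_zero_iff d).1 h.1
    · subst h; simp [exponents]
  · rw [zero_pow hn, zero_smul]

/-! ### Newton's identity for the complete homogeneous functions. -/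

theorem coeff_p_mul {K : Type*} [Field K] (r : ℕ) (hr : 1 ≤ r) (f : MvPowerSeries ℕ K)
    (d : ℕ →₀ ℕ) :
    MvPowerSeries.coeff d ((p K r : MvPowerSeries ℕ K) * f) =
      ∑ i ∈ d.support with r ≤ d i, MvPowerSeries.coeff (d - Finsupp.single i r) f := by
  classical
  rw [MvPowerSeries.coeff_mul]
  simp only [coeff_p, ite_mul, one_mul, zero_mul]
  rw [← Finset.sum_filter]
  symm
  refine Finset.sum_bij (fun i _ => (Finsupp.single i r, d - Finsupp.single i r)) ?_ ?_ ?_ ?_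
  · intro i hi
    have hi := (Finset.mem_filter.1 hi).2
    rw [Finset.mem_filter, HasAntidiagonal.mem_antidiagonal]
    refine ⟨add_tsub_cancel_of_le ?_, i, rfl⟩
    exact Finsupp.single_le_iff.2 hi
  · intro i _ j _ hij
    exact (Finsupp.single_left_inj (by omega)).1 (Prod.ext_iff.1 hij).1
  · rintro ⟨a, b⟩ hab
    obtain ⟨hab, i, hi⟩ := Finset.mem_filter.1 hab
    rw [HasAntidiagonal.mem_antidiagonal] at hab
    simp only at hi hab
    subst hi hab
    refine ⟨i, ?_, ?_⟩
    · rw [Finset.mem_filter, Finsupp.mem_support_iff, Finsupp.add_apply, Finsupp.single_eq_same]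
      omega
    · simp
  · intro i _
    rfl

/-- At x^d the right side counts pairs (i, r) with 1 ≤ r ≤ d_i, of which there are ∑ d_i = n + 1. -/
theorem newton_h {K : Type*} [Field K] (n : ℕ) :
    ((n + 1 : ℕ) : K) • h K (n + 1) =
      ∑ y ∈ antidiagonal n, p K (y.1 + 1) * h K y.2 := by
  apply Subtype.ext
  ext d
  rw [Subalgebra.coe_smul, MvPowerSeries.coeff_smul, h, coeff_series]
  have hsum : ((∑ y ∈ antidiagonal n, p K (y.1 + 1) * h K y.2 : Sym K) : MvPowerSeries ℕ K) =
      ∑ y ∈ antidiagonal n, (p K (y.1 + 1) : MvPowerSeries ℕ K) * (h K y.2 : MvPowerSeries ℕ K) := by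
    simp
  rw [hsum, map_sum]
  simp only [coeff_p_mul _ (Nat.le_add_left 1 _), h, coeff_series]
  simp only [Finset.sum_filter]
  rw [Finset.sum_comm]
  have hdeg : ∀ i r, r ≤ d i → (d - Finsupp.single i r).degree + r = d.degree := by
    intro i r hir
    conv_rhs => rw [← tsub_add_cancel_of_le (Finsupp.single_le_iff.2 hir), map_add,
      Finsupp.degree_single]
  split_ifs with hn
  · have : ∀ i ∈ d.support, (∑ y ∈ antidiagonal n, if y.1 + 1 ≤ d i then
        (if (d - Finsupp.single i (y.1 + 1)).degree = y.2 then (1 : K) else 0) else 0) = d i := by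
      intro i hi
      have hle : d i ≤ n + 1 := by rw [← hn]; exact Finsupp.le_degree i d
      rw [Finset.Nat.sum_antidiagonal_eq_sum_range_succ_mk]
      have : ∀ k ∈ Finset.range n.succ, (if k + 1 ≤ d i then
          (if (d - Finsupp.single i (k + 1)).degree = n - k then (1 : K) else 0) else 0) =
          if k < d i then 1 else 0 := by
        intro k hk
        refine if_ctx_congr Iff.rfl (fun hk' => ?_) (fun _ => rfl)
        have := hdeg i (k + 1) hk'
        rw [if_pos]; omega
      rw [Finset.sum_congr rfl this, ← Finset.sum_filter, Finset.sum_const, nsmul_eq_mul, mul_one]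
      congr 1
      rw [show (Finset.range n.succ).filter (· < d i) = Finset.range (d i) by
        ext k; simp; omega, Finset.card_range]
    rw [Finset.sum_congr rfl this, ← hn, degree_eq_sum]
    simp
  · rw [mul_zero]
    symm
    refine Finset.sum_eq_zero fun i _ => Finset.sum_eq_zero fun y hy => ?_
    rw [HasAntidiagonal.mem_antidiagonal] at hy
    split_ifs with h1 h2
    · have := hdeg i _ h1
      omega
    · rfl
    · rfl

/-! ### Effect of the plethystic shift on infinite products. -/

/-- The substitution `φ ↦ φ(t s / z)`, where `s` is the variable of the outer power series. -/
def scaleInv {K : Type*} [Field K] (t : K) :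
    PowerSeries K →+* PowerSeries (LaurentSeries (Sym K)) :=
  (PowerSeries.rescale (HahnSeries.single (-1 : ℤ) (algebraMap K (Sym K) t))).comp
    (PowerSeries.map ((HahnSeries.C : Sym K →+* LaurentSeries (Sym K)).comp
      (algebraMap K (Sym K))))

theorem coeff_scaleInv {K : Type*} [Field K] (t : K) (φ : PowerSeries K) (n : ℕ) :
    coeff n (scaleInv t φ) =
      HahnSeries.single (-(n : ℤ)) (algebraMap K (Sym K) (t ^ n * coeff n φ)) := by
  rw [scaleInv, RingHom.comp_apply, coeff_rescale, coeff_map, HahnSeries.single_pow,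
    RingHom.comp_apply, HahnSeries.C_apply, HahnSeries.single_mul_single, map_mul (algebraMap K (Sym K)),
    map_pow (algebraMap K (Sym K))]
  simp

theorem scaleInv_C_mul_X_pow {K : Type*} [Field K] (t κ : K) (k : ℕ) :
    scaleInv t (C κ * X ^ k) = scaleInv 1 (C (t ^ k * κ) * X ^ k) := by
  ext1 n
  rw [coeff_scaleInv, coeff_scaleInv, coeff_C_mul_X_pow, coeff_C_mul_X_pow]
  split_ifs with h
  · subst h; simp
  · simp

/-- Functions `φ` for which the infinite product `F = ∏ φ(s x_i)` satisfies
`F[X - (1 - 1/q)/z] φ(s/z) = F φ(s/(qz))`. -/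
def ShiftsTo {K : Type*} [Field K] [CharZero K] (q : K) (φ : PowerSeries K) : Prop :=
  PowerSeries.map (shift q : Sym K →+* LaurentSeries (Sym K)) (multGen φ) * scaleInv 1 φ =
    PowerSeries.map HahnSeries.C (multGen φ) * scaleInv q⁻¹ φ

theorem ShiftsTo.mul {K : Type*} [Field K] [CharZero K] {q : K} {φ ψ : PowerSeries K}
    (hφ : coeff 0 φ = 1) (hψ : coeff 0 ψ = 1) (h1 : ShiftsTo q φ) (h2 : ShiftsTo q ψ) :
    ShiftsTo q (φ * ψ) := by
  unfold ShiftsTo at *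
  rw [multGen_mul hφ hψ, map_mul, map_mul, map_mul, map_mul, mul_mul_mul_comm, h1, h2,
    mul_mul_mul_comm]

/-- Both sides of `ShiftsTo` are multiplicative in φ. The relations for φ and ψ multiply to 1 = 1,
and the one for φ is between units, so it can be cancelled. -/
theorem ShiftsTo.inv {K : Type*} [Field K] [CharZero K] {q : K} {φ ψ : PowerSeries K}
    (hφ : coeff 0 φ = 1) (hψ : coeff 0 ψ = 1) (hm : φ * ψ = 1) (h1 : ShiftsTo q φ) :
    ShiftsTo q ψ := by
  unfold ShiftsTo at *
  have hG : multGen φ * multGen ψ = 1 := by rw [← multGen_mul hφ hψ, hm, multGen_one]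
  have a1 := congrArg (PowerSeries.map (shift q : Sym K →+* LaurentSeries (Sym K))) hG
  have a2 := congrArg (PowerSeries.map (HahnSeries.C : Sym K →+* LaurentSeries (Sym K))) hG
  have a3 := congrArg (scaleInv (1 : K)) hm
  have a4 := congrArg (scaleInv q⁻¹) hm
  rw [map_mul, map_one] at a1 a2 a3 a4
  have u : IsUnit (PowerSeries.map (shift q : Sym K →+* LaurentSeries (Sym K)) (multGen φ) *
      scaleInv 1 φ) := (IsUnit.of_mul_eq_one _ a1).mul (IsUnit.of_mul_eq_one _ a3)
  refine u.mul_left_cancel ?_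
  rw [mul_mul_mul_comm, a1, a3, h1, mul_mul_mul_comm, a2, a4]

/-- Torsion-freeness of the Laurent series, read off coefficient by coefficient in `K`; it allows a
power series to be recovered from its derivative. -/
theorem mul_natCast_succ_injective {K : Type*} [Field K] [CharZero K] (n : ℕ)
    (x y : LaurentSeries (Sym K))
    (hxy : x * ((n : LaurentSeries (Sym K)) + 1) = y * ((n : LaurentSeries (Sym K)) + 1)) :
    x = y := by
  have hxy' : (n + 1) • x = (n + 1) • y := by
    rw [nsmul_eq_mul, mul_comm, nsmul_eq_mul, mul_comm _ y]; push_cast; exact hxy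
  ext a d
  have h1 := congrArg (fun y : LaurentSeries (Sym K) =>
    MvPowerSeries.coeff d ((y.coeff a : Sym K) : MvPowerSeries ℕ K)) hxy'
  simp only [HahnSeries.coeff_nsmul, Pi.smul_apply] at h1
  rw [← Nat.cast_smul_eq_nsmul K, ← Nat.cast_smul_eq_nsmul K, Subalgebra.coe_smul,
    Subalgebra.coe_smul, MvPowerSeries.coeff_smul, MvPowerSeries.coeff_smul] at h1
  exact mul_left_cancel₀ (Nat.cast_ne_zero.2 (Nat.succ_ne_zero n)) h1

/-- The equation U' = UQ determines each coefficient of U from the earlier ones. -/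
theorem eq_of_derivative_eq_mul {L : Type*} [CommSemiring L]
    (hL : ∀ (n : ℕ) (x y : L), x * ((n : L) + 1) = y * ((n : L) + 1) → x = y)
    {U W Q : PowerSeries L} (hU : d⁄dX _ U = U * Q) (hW : d⁄dX _ W = W * Q)
    (h0 : coeff 0 U = coeff 0 W) : U = W := by
  ext1 n
  induction n using Nat.strong_induction_on with
  | _ n ih =>
    rcases n with _ | n
    · exact h0
    · apply hL n
      rw [← coeff_derivative, ← coeff_derivative, hU, hW, coeff_mul, coeff_mul]
      refine Finset.sum_congr rfl fun y hy => ?_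
      rw [HasAntidiagonal.mem_antidiagonal] at hy
      rw [ih y.1 (by omega)]

/-- Logarithmic derivatives add under multiplication, so products with equal constant terms can be
compared without taking logarithms. -/
theorem mul_eq_mul_of_derivative {L : Type*} [CommSemiring L]
    (hL : ∀ (n : ℕ) (x y : L), x * ((n : L) + 1) = y * ((n : L) + 1) → x = y)
    {F F' T T' P P' R R' : PowerSeries L} (hF : d⁄dX _ F = F * P) (hF' : d⁄dX _ F' = F' * P')
    (hT : d⁄dX _ T = T * R) (hT' : d⁄dX _ T' = T' * R') (hadd : P + R = P' + R')
    (h0 : coeff 0 F * coeff 0 T = coeff 0 F' * coeff 0 T') : F * T = F' * T' := by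
  refine eq_of_derivative_eq_mul hL (Q := P + R) ?_ ?_ ?_
  · rw [Derivation.leibniz, hF, hT, smul_eq_mul, smul_eq_mul]; ring
  · rw [Derivation.leibniz, hF', hT', hadd, smul_eq_mul, smul_eq_mul]; ring
  · simpa using h0

theorem derivative_geom {R : Type*} [CommSemiring R] (x : R) :
    d⁄dX R (PowerSeries.mk fun n => x ^ n) =
      (PowerSeries.mk fun n => x ^ n) * PowerSeries.mk fun n => x ^ (n + 1) := by
  ext1 n
  rw [coeff_derivative, coeff_mul]
  simp only [coeff_mk]
  rw [Finset.sum_congr rfl (g := fun _ => x ^ (n + 1))]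
  · simp [mul_comm]
  · intro y hy
    rw [← HasAntidiagonal.mem_antidiagonal.1 hy, ← pow_add, add_assoc]

theorem scaleInv_geom {K : Type*} [Field K] (t c : K) :
    scaleInv t (PowerSeries.mk fun i => c ^ i) = PowerSeries.mk fun n =>
      (HahnSeries.single (-1 : ℤ) (algebraMap K (Sym K) (t * c))) ^ n := by
  ext1 n
  rw [coeff_scaleInv, coeff_mk, coeff_mk, HahnSeries.single_pow, ← map_pow, mul_pow]
  simp

/-- Newton's identity says that H(cs) has logarithmic derivative ∑ c^{n+1} p_{n+1} s^n. The shift is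
defined on power sums, so this is the form in which it can be computed. -/
theorem derivative_multGen_geom {K : Type*} [Field K] (c : K) :
    d⁄dX _ (multGen (PowerSeries.mk fun i => c ^ i)) =
      multGen (PowerSeries.mk fun i => c ^ i) *
        PowerSeries.mk fun n => c ^ (n + 1) • p K (n + 1) := by
  ext1 n
  rw [coeff_derivative, mul_comm (multGen _), coeff_mul]
  simp only [multGen, coeff_mk, multSeries_geom]
  have h2 : h K (n + 1) * ((n : Sym K) + 1) = ((n + 1 : ℕ) : K) • h K (n + 1) := by
    rw [Nat.cast_smul_eq_nsmul, nsmul_eq_mul, mul_comm]; push_cast; rfl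
  rw [smul_mul_assoc, h2, newton_h, Finset.smul_sum]
  refine Finset.sum_congr rfl fun y hy => ?_
  rw [smul_mul_smul_comm, ← HasAntidiagonal.mem_antidiagonal.1 hy, ← pow_add]
  congr 2
  ring

theorem derivative_map_eq_mul {R S : Type*} [CommSemiring R] [CommSemiring S] (g : R →+* S)
    {f P : PowerSeries R} (hf : d⁄dX R f = f * P) :
    d⁄dX S (PowerSeries.map g f) = PowerSeries.map g f * PowerSeries.map g P := by
  rw [← map_mul, ← hf]
  ext1 n
  simp [coeff_derivative]

theorem algebraMap_laurent {K : Type*} [Field K] (x : K) :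
    algebraMap K (LaurentSeries (Sym K)) x = HahnSeries.C (algebraMap K (Sym K) x) := by
  rw [HahnSeries.algebraMap_apply', PowerSeries.algebraMap_apply, HahnSeries.ofPowerSeries_C]

theorem shift_smul {K : Type*} [Field K] [CharZero K] (q c : K) (f : Sym K) :
    shift q (c • f) = HahnSeries.C (algebraMap K (Sym K) c) * shift q f := by
  rw [Algebra.smul_def, map_mul, AlgHom.commutes, algebraMap_laurent]

theorem coeff_zero_multGen {K : Type*} [Field K] (φ : PowerSeries K) :
    coeff 0 (multGen φ) = 1 := by
  rw [← coeff_zero_one (R := Sym K), ← multGen_one (K := K)]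
  simp only [multGen, coeff_mk]
  refine Subtype.ext (MvPowerSeries.ext fun d => ?_)
  rw [coeff_multSeries, coeff_multSeries]
  refine if_ctx_congr Iff.rfl (fun h0 => ?_) fun _ => rfl
  rw [(Finsupp.degree_eq_zero_iff d).1 h0]
  simp

/-- Comparing logarithmic derivatives reduces the claim to the defining rule p_n ↦ p_n - (1 -
q^{-n}) z^{-n}, with the geometric series in c/z and c/(qz) supplying the correction terms. -/
theorem shiftsTo_geom {K : Type*} [Field K] [CharZero K] (q c : K) :
    ShiftsTo q (PowerSeries.mk fun i => c ^ i) := by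
  unfold ShiftsTo
  rw [scaleInv_geom, scaleInv_geom]
  have h1 := derivative_map_eq_mul (shift q : Sym K →+* LaurentSeries (Sym K))
    (derivative_multGen_geom c)
  have h2 := derivative_map_eq_mul (HahnSeries.C : Sym K →+* LaurentSeries (Sym K))
    (derivative_multGen_geom c)
  refine mul_eq_mul_of_derivative mul_natCast_succ_injective h1 h2
    (derivative_geom _) (derivative_geom _) ?_ ?_
  · ext1 n
    rw [map_add, map_add, coeff_map, coeff_map, coeff_mk, coeff_mk, coeff_mk]
    change shift q _ + _ = _
    have hn : (n + 1) • (-1 : ℤ) = -((n + 1 : ℕ) : ℤ) := by simp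
    rw [shift_smul, shift, plethysm_p _ _ (Nat.le_add_left 1 n), Algebra.smul_def,
      map_mul HahnSeries.C, HahnSeries.single_pow, HahnSeries.single_pow, hn,
      ← map_pow, ← map_pow]
    have h1 : HahnSeries.C (algebraMap K (Sym K) (c ^ (n + 1))) *
        HahnSeries.single (-((n + 1 : ℕ) : ℤ)) (algebraMap K (Sym K) (1 - q⁻¹ ^ (n + 1))) +
        HahnSeries.single (-((n + 1 : ℕ) : ℤ)) (algebraMap K (Sym K) ((q⁻¹ * c) ^ (n + 1))) =
        HahnSeries.single (-((n + 1 : ℕ) : ℤ)) (algebraMap K (Sym K) ((1 * c) ^ (n + 1))) := by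
      rw [HahnSeries.C_apply, HahnSeries.single_mul_single, zero_add, ← map_mul,
        ← HahnSeries.single_add, ← map_add]
      congr 2
      rw [one_mul, mul_pow]
      ring
    rw [← h1]
    ring
  · rw [coeff_map, coeff_map, coeff_zero_multGen, map_one, map_one]
    simp

theorem geom_mul_one_add {K : Type*} [Field K] (c : K) :
    (PowerSeries.mk fun i => (-c) ^ i) * (1 + C c * X) = 1 := by
  ext1 n
  rw [mul_add, mul_one, mul_left_comm, map_add, coeff_C_mul, coeff_one]
  rcases n with _ | n
  · simp
  · rw [coeff_succ_mul_X, coeff_mk, coeff_mk, pow_succ]; simp; ring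

theorem shiftsTo_one_add {K : Type*} [Field K] [CharZero K] (q c : K) :
    ShiftsTo q (1 + C c * X) :=
  (shiftsTo_geom q (-c)).inv (by simp) (by simp) (geom_mul_one_add c)

/-! ### Creation operators on the homogeneous parts of an infinite product. -/

/-- After multiplication by the unit φ(s/z), both sides contain c(-·)φ(·) at a single argument.
Being a monomial of degree k, it changes only by q^{-k} between s/(qz) and s/z. -/
theorem scaleInv_mul_map_shift {K : Type*} [Field K] [CharZero K] {q : K} {φ c : PowerSeries K}
    {κ : K} {k : ℕ} (hφ : coeff 0 φ = 1) (hs : ShiftsTo q φ)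
    (hc : rescale (-1) c * φ = C κ * X ^ k) :
    scaleInv q⁻¹ (rescale (-1) c) *
        PowerSeries.map (shift q : Sym K →+* LaurentSeries (Sym K)) (multGen φ) =
      scaleInv 1 (C (q⁻¹ ^ k) * rescale (-1) c) * PowerSeries.map HahnSeries.C (multGen φ) := by
  have hφ' : φ * φ⁻¹ = 1 := PowerSeries.mul_inv_cancel φ (by
    rw [← coeff_zero_eq_constantCoeff_apply, hφ]; exact one_ne_zero)
  have hu : IsUnit (scaleInv (1 : K) φ) := by
    refine IsUnit.of_mul_eq_one (scaleInv 1 φ⁻¹) ?_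
    rw [← map_mul, hφ', map_one]
  refine hu.mul_right_cancel ?_
  unfold ShiftsTo at hs
  rw [mul_assoc, hs, mul_left_comm, ← map_mul (scaleInv q⁻¹), hc, mul_right_comm,
    ← map_mul (scaleInv 1), mul_assoc (C (q⁻¹ ^ k)), hc, scaleInv_C_mul_X_pow, map_mul C, mul_assoc,
    mul_comm]

theorem coeff_zero_single_mul_mul_omega {K : Type*} [Field K] (a : Sym K) (r : ℕ)
    (y : LaurentSeries (Sym K)) :
    (HahnSeries.single (-(r : ℤ)) a * y * omega K).coeff 0 = a * (y * omega K).coeff r := by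
  rw [mul_assoc, HahnSeries.coeff_single_mul, zero_sub, neg_neg]

theorem coeff_C_mul_omega {K : Type*} [Field K] (f : Sym K) (r : ℕ) :
    (HahnSeries.C f * omega K).coeff (r : ℤ) = f * h K r := by
  rw [HahnSeries.C_apply, HahnSeries.coeff_single_mul, sub_zero, omega,
    LaurentSeries.coeff_coe_powerSeries, coeff_mk]

/-- The part of the scalar depending on `r` becomes the substitution s ↦ -s/q in the weight series,
leaving the constant -q outside. -/
theorem creation_natCast {K : Type*} [Field K] [CharZero K] {q : K} (hq : q ≠ 0) (r : ℕ)
    (f : Sym K) :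
    creation q (r : ℤ) f = (-q) • (q⁻¹ ^ r * (-1) ^ r) • (shift q f * omega K).coeff (r : ℤ) := by
  rw [creation, smul_smul]
  congr 1
  have h1 : -1 / q ≠ 0 := div_ne_zero (neg_ne_zero.2 one_ne_zero) hq
  rw [zpow_sub_one₀ h1, zpow_natCast, ← mul_pow, mul_comm]
  congr 1
  · field_simp
  · congr 1
    field_simp

/-- The creation operators applied to the homogeneous parts of an infinite product `∏ φ(s x_i)`,
weighted by a power series `c` such that `c(-s) φ(s)` is a monomial. -/
theorem sum_creation_multSeries {K : Type*} [Field K] [CharZero K] {q : K} (hq : q ≠ 0)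
    {φ c : PowerSeries K} {κ : K} {k : ℕ} (hφ : coeff 0 φ = 1) (hs : ShiftsTo q φ)
    (hc : rescale (-1) c * φ = C κ * X ^ k) (n : ℕ) :
    ∑ y ∈ antidiagonal n, coeff y.1 c • creation q (y.1 : ℤ) (multSeries φ y.2) =
      (-q * q⁻¹ ^ k) •
        ∑ y ∈ antidiagonal n, ((-1) ^ y.1 * coeff y.1 c) • (multSeries φ y.2 * h K y.1) := by
  -- Extract s^n z^0 after multiplying by Ω[zX]: the z^{-r} carried by the r-th weight selects the
  -- coefficient of z^r that defines C_r.
  have key := congrArg (fun g : PowerSeries (LaurentSeries (Sym K)) =>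
    (coeff n g * omega K).coeff 0) (scaleInv_mul_map_shift hφ hs hc)
  simp only [coeff_mul, Finset.sum_mul, HahnSeries.coeff_sum] at key
  simp only [coeff_map, coeff_scaleInv, coeff_zero_single_mul_mul_omega, coeff_C_mul_omega,
    multGen, coeff_mk, coeff_rescale, coeff_C_mul, ← Algebra.smul_def] at key
  rw [mul_smul]
  calc _ = (-q) • ∑ y ∈ antidiagonal n, (q⁻¹ ^ y.1 * ((-1) ^ y.1 * coeff y.1 c)) •
        (shift q (multSeries φ y.2) * omega K).coeff (y.1 : ℤ) := by
        rw [Finset.smul_sum]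
        refine Finset.sum_congr rfl fun y _ => ?_
        rw [creation_natCast hq, smul_smul, smul_smul, smul_smul]
        congr 1
        ring
    _ = _ := by
        congr 1
        refine Eq.trans key ?_
        rw [Finset.smul_sum]
        refine Finset.sum_congr rfl fun y _ => ?_
        rw [smul_smul, one_pow, one_mul]

/-! ### Generating functions E and H, and e_n through creation operators. -/

theorem multGen_one_add {K : Type*} [Field K] (c : K) :
    multGen (1 + C c * X) = PowerSeries.mk fun n => c ^ n • e K n := by
  ext1 n
  rw [multGen, coeff_mk, coeff_mk, multSeries_one_add]

theorem multGen_geom {K : Type*} [Field K] (c : K) :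
    multGen (PowerSeries.mk fun i => c ^ i) = PowerSeries.mk fun n => c ^ n • h K n := by
  ext1 n
  rw [multGen, coeff_mk, coeff_mk, multSeries_geom]

theorem multGen_geom_mul {K : Type*} [Field K] (c : K) :
    multGen (PowerSeries.mk fun i => (-c) ^ i) * multGen (1 + C c * X) = 1 := by
  rw [← multGen_mul (by simp) (by simp), geom_mul_one_add, multGen_one]

theorem h_zero {K : Type*} [Field K] : h K 0 = 1 := by
  rw [← coeff_zero_multGen (PowerSeries.mk fun i => (1 : K) ^ i), multGen_geom, coeff_mk, pow_zero,
    one_smul]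

theorem e_zero {K : Type*} [Field K] : e K 0 = 1 := by
  rw [← coeff_zero_multGen (1 + C (1 : K) * X), multGen_one_add, coeff_mk, pow_zero, one_smul]

/-- Apply `sum_creation_multSeries` with φ = 1+s and c = s/(1-s), so that c(-s)φ(s) = -s. What
remains is -∑_{r≥1} (-1)^r h_r e_{n+1-r}, which E(s)H(-s) = 1 evaluates. -/
theorem e_eq_sum_creation {K : Type*} [Field K] [CharZero K] {q : K} (hq : q ≠ 0) (n : ℕ) :
    e K (n + 1) = ∑ y ∈ antidiagonal n, creation q ((y.1 + 1 : ℕ) : ℤ) (e K y.2) := by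
  have hE : ∀ m, multSeries (1 + C (1 : K) * X) m = e K m := fun m => by
    rw [multSeries_one_add, one_pow, one_smul]
  have hc : rescale (-1 : K) (X * PowerSeries.mk fun i => (1 : K) ^ i) * (1 + C (1 : K) * X) =
      C (-1) * X ^ 1 := by
    have hg : rescale (-1 : K) (PowerSeries.mk fun i => (1 : K) ^ i) =
        PowerSeries.mk fun i => (-1 : K) ^ i := by
      ext1 i; simp [coeff_rescale]
    rw [map_mul, hg, mul_assoc, geom_mul_one_add, rescale_X, pow_one, mul_one]
  have h1 := sum_creation_multSeries hq (by simp) (shiftsTo_one_add q 1) hc (n + 1)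
  have h2 := congrArg (coeff (n + 1)) (multGen_geom_mul (1 : K))
  rw [coeff_one, if_neg (Nat.succ_ne_zero n), multGen_geom, multGen_one_add, coeff_mul] at h2
  simp only [hE] at h1
  rw [Finset.Nat.sum_antidiagonal_succ] at h1 h2
  rw [Finset.Nat.sum_antidiagonal_succ] at h1
  simp only [coeff_succ_X_mul, coeff_zero_X_mul, zero_smul, zero_add, coeff_mk, one_pow, one_smul,
    pow_zero, mul_one, mul_zero, pow_one, mul_inv_cancel₀ hq, neg_mul, neg_smul] at h1 h2
  rw [h1, neg_eq_iff_add_eq_zero.2]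
  rw [← h2, add_comm]
  rw [h_zero, one_mul]
  congr 1
  refine Finset.sum_congr rfl fun y _ => ?_
  rw [smul_mul_assoc, mul_comm]

/-! ### Two-column monomial functions from a quadratic φ. -/

/-- The pairs `(k, l)` with `2 k + l = n`. -/
def twoColumnPairs (n : ℕ) : Finset (ℕ × ℕ) :=
  (range (n + 1) ×ˢ range (n + 1)).filter fun x => 2 * x.1 + x.2 = n

theorem mem_twoColumnPairs {n : ℕ} {x : ℕ × ℕ} : x ∈ twoColumnPairs n ↔ 2 * x.1 + x.2 = n := by
  rw [twoColumnPairs, Finset.mem_filter, Finset.mem_product, Finset.mem_range, Finset.mem_range]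
  omega

/-- `(-1)^k m_{2^k 1^l}`. -/
def signedTwoColumn (K : Type*) [Field K] (k l : ℕ) : Sym K := (-1) ^ k * m K (twoColumn k l)

theorem exists_eq_replicate_add_replicate (M : Multiset ℕ) (hM : ∀ a ∈ M, a = 1 ∨ a = 2) :
    ∃ k l, M = Multiset.replicate k 2 + Multiset.replicate l 1 := by
  refine ⟨M.count 2, (M.filter fun a => ¬ a = 2).card, ?_⟩
  conv_lhs => rw [← Multiset.filter_add_not (fun a => a = 2) M, Multiset.filter_eq']
  congr 1
  refine Multiset.eq_replicate_card.2 fun a ha => ?_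
  obtain ⟨h1, h2⟩ := Multiset.mem_filter.1 ha
  exact (hM a h1).resolve_right h2

/-- Here `g` lists the coefficients of 1 + X - uX^2. A part of size at least 3 kills the product;
otherwise the multiplicities of 2 and 1 determine the only surviving pair. -/
theorem prod_map_eq_sum_twoColumnPairs {R : Type*} [CommRing R] (u : R) (g : ℕ → R) (h1 : g 1 = 1)
    (h2 : g 2 = -u) (h3 : ∀ a, 3 ≤ a → g a = 0) (M : Multiset ℕ) (hM : ∀ a ∈ M, a ≠ 0) (n : ℕ)
    (hn : M.sum = n) :
    (M.map g).prod = ∑ x ∈ twoColumnPairs n, u ^ x.1 * ((-1) ^ x.1 *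
      if M = Multiset.replicate x.1 2 + Multiset.replicate x.2 1 then 1 else 0) := by
  by_cases hex : ∀ a ∈ M, a = 1 ∨ a = 2
  · obtain ⟨k, l, rfl⟩ := exists_eq_replicate_add_replicate M hex
    rw [Finset.sum_eq_single (k, l)]
    · simp [h1, h2, neg_pow u, mul_comm]
    · rintro ⟨k', l'⟩ _ hne
      rw [if_neg, mul_zero, mul_zero]
      intro heq
      have e1 := congrArg (Multiset.count 2) heq
      have e2 := congrArg (Multiset.count 1) heq
      simp [Multiset.count_replicate] at e1 e2
      exact hne (by rw [e1, e2])
    · intro hnot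
      refine absurd (mem_twoColumnPairs.2 ?_) hnot
      simpa [mul_comm] using hn
  · push Not at hex
    obtain ⟨a, ha, ha1, ha2⟩ := hex
    have h0 := hM a ha
    rw [Multiset.prod_eq_zero (Multiset.mem_map.2 ⟨a, ha, h3 a (by omega)⟩)]
    symm
    refine Finset.sum_eq_zero fun x _ => ?_
    rw [if_neg, mul_zero, mul_zero]
    rintro rfl
    rcases Multiset.mem_add.1 ha with h | h
    · exact ha2 (Multiset.eq_of_mem_replicate h)
    · exact ha1 (Multiset.eq_of_mem_replicate h)

theorem one_add_mul_one_add {R : Type*} [CommRing R] {a b : R} (hab : a + b = 1) :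
    (1 + C a * X) * (1 + C b * X) = (1 + X + C (a * b) * X ^ 2 : PowerSeries R) := by
  have : (C (1 : R)) = (C a + C b : PowerSeries R) := by rw [← hab, map_add]
  rw [map_one] at this
  rw [map_mul]
  linear_combination (-X) * this

theorem multSeries_quadratic {K : Type*} [Field K] {a b : K} (hab : a + b = 1) (n : ℕ) :
    multSeries ((1 + C a * X) * (1 + C b * X)) n =
      ∑ x ∈ twoColumnPairs n, (-(a * b)) ^ x.1 • signedTwoColumn K x.1 x.2 := by
  refine Subtype.ext (MvPowerSeries.ext fun d => ?_)
  have hφ := one_add_mul_one_add hab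
  have hsum : ((∑ x ∈ twoColumnPairs n, (-(a * b)) ^ x.1 • signedTwoColumn K x.1 x.2 : Sym K) :
      MvPowerSeries ℕ K) = ∑ x ∈ twoColumnPairs n, MvPowerSeries.C ((-(a * b)) ^ x.1 * (-1) ^ x.1) *
        (m K (twoColumn x.1 x.2) : MvPowerSeries ℕ K) := by
    rw [AddSubmonoidClass.coe_finsetSum]
    refine Finset.sum_congr rfl fun x _ => ?_
    rw [Subalgebra.coe_smul, signedTwoColumn, Subalgebra.coe_mul, MvPowerSeries.smul_eq_C_mul,
      map_mul, mul_assoc]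
    simp
  rw [hsum, map_sum, multSeries, coeff_series]
  have hm : ∀ x : ℕ × ℕ, MvPowerSeries.coeff d (m K (twoColumn x.1 x.2) : MvPowerSeries ℕ K) =
      if exponents d = Multiset.replicate x.1 2 + Multiset.replicate x.2 1 then 1 else 0 :=
    fun x => rfl
  simp only [MvPowerSeries.coeff_C_mul, hm, mul_assoc]
  split_ifs with hn
  · refine prod_map_eq_sum_twoColumnPairs (-(a * b)) _ ?_ ?_ ?_ (exponents d) ?_ n hn
    · rw [hφ, map_add, map_add, coeff_C_mul]; simp [coeff_one, coeff_X_pow]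
    · rw [hφ, map_add, map_add, coeff_C_mul]; simp [coeff_one, coeff_X, coeff_X_pow]
    · intro i hi
      rw [hφ, map_add, map_add, coeff_C_mul]
      simp [coeff_one, coeff_X, coeff_X_pow, show i ≠ 0 by omega, show i ≠ 1 by omega,
        show i ≠ 2 by omega]
    · intro i hi
      obtain ⟨j, hj, rfl⟩ := Multiset.mem_map.1 hi
      exact Finsupp.mem_support_iff.1 hj
  · symm
    refine Finset.sum_eq_zero fun x hx => ?_
    rw [if_neg, mul_zero, mul_zero]
    intro heq
    apply hn
    rw [← sum_exponents, heq, ← mem_twoColumnPairs.1 hx]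
    simp [mul_comm]

/-! ### The Fibonacci-type polynomials and the e_n term. -/

/-- The coefficient of `y^n` in `1 / (1 - y - u y^2)`. -/
def fibPoly {R : Type*} [CommSemiring R] (u : R) (n : ℕ) : R :=
  ∑ x ∈ antidiagonal n, (x.1.choose x.2 : R) * u ^ x.2

theorem fibPoly_add_two {R : Type*} [CommSemiring R] (u : R) (n : ℕ) :
    fibPoly u (n + 2) = fibPoly u (n + 1) + u * fibPoly u n := by
  unfold fibPoly
  rw [Finset.Nat.antidiagonal_succ_succ', Finset.Nat.antidiagonal_succ', Finset.mul_sum]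
  simp only [Finset.sum_cons, Finset.sum_map, Function.Embedding.coe_prodMap,
    Function.Embedding.coeFn_mk, Prod.map_fst, Prod.map_snd, Function.Embedding.coe_refl, id_eq,
    Nat.choose_zero_right, Nat.choose_zero_succ, Nat.choose_succ_succ, Nat.cast_add, Nat.cast_zero,
    Nat.cast_one, Nat.succ_eq_add_one, zero_mul, zero_add, pow_zero, mul_one]
  rw [add_assoc, ← Finset.sum_add_distrib]
  congr 1
  refine Finset.sum_congr rfl fun x _ => ?_
  ring

/-- Substitute (k + l, k) for the antidiagonal pair; pairs not of this form have vanishing binomial.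
-/
theorem fibPoly_eq_sum {R : Type*} [CommSemiring R] (u : R) (n : ℕ) :
    fibPoly u n = ∑ x ∈ twoColumnPairs n, ((x.1 + x.2).choose x.1 : R) * u ^ x.1 := by
  unfold fibPoly
  symm
  refine Finset.sum_of_injOn (fun x => (x.1 + x.2, x.1)) ?_ ?_ ?_ ?_
  · rintro ⟨i, j⟩ _ ⟨i', j'⟩ _ h
    simp only [Prod.mk.injEq] at h ⊢
    omega
  · rintro ⟨i, j⟩ h
    have := mem_twoColumnPairs.1 (Finset.mem_coe.1 h)
    rw [Finset.mem_coe, HasAntidiagonal.mem_antidiagonal]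
    simp only at *
    omega
  · rintro ⟨i, j⟩ hx hnot
    rw [HasAntidiagonal.mem_antidiagonal] at hx
    simp only at *
    rw [Nat.choose_eq_zero_of_lt, Nat.cast_zero, zero_mul]
    by_contra hlt
    refine hnot ⟨(j, i - j), ?_, ?_⟩
    · rw [Finset.mem_coe, mem_twoColumnPairs]; simp only; omega
    · simp only [Prod.mk.injEq, and_true]; omega
  · intro x _
    rfl

/-- Binet's formula: since a + b = 1, both a and b are roots of y^2 = y + u with u = -ab. -/
theorem sub_mul_fibPoly {R : Type*} [CommRing R] {a b : R} (hab : a + b = 1) (n : ℕ) :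
    (b - a) * fibPoly (-(a * b)) n = b ^ (n + 1) - a ^ (n + 1) := by
  induction n using Nat.twoStepInduction with
  | zero => simp [fibPoly]
  | one =>
    simp [fibPoly, Finset.Nat.antidiagonal_succ]
    linear_combination (a - b) * hab
  | more n h1 h2 =>
    rw [fibPoly_add_two, mul_add, h2, mul_left_comm, h1]
    linear_combination (a ^ (n + 2) - b ^ (n + 2)) * hab

theorem fibPoly_mul {R : Type*} [CommRing R] {a b : R} (hab : a + b = 1) :
    rescale (-1) (PowerSeries.mk (fibPoly (-(a * b)))) * ((1 + C a * X) * (1 + C b * X)) = 1 := by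
  have hφ := one_add_mul_one_add hab
  rw [hφ, mul_add, mul_add, mul_one, mul_left_comm]
  ext n
  rw [map_add, map_add, coeff_C_mul, coeff_one]
  rcases n with _ | _ | n
  · simp [fibPoly]
  · rw [coeff_succ_mul_X, show X ^ 2 = (X * X : PowerSeries R) by ring, ← mul_assoc,
      coeff_succ_mul_X]
    simp [fibPoly, coeff_rescale, Finset.Nat.antidiagonal_succ]
  · rw [coeff_succ_mul_X, coeff_mul_X_pow _ 2 n]
    simp only [coeff_rescale, coeff_mk]
    rw [fibPoly_add_two, if_neg (by omega)]
    ring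

/-- With F = E(as)E(bs), Binet's formula writes the weighted h-series as (b H(-as) - a
H(-bs))/(b-a). Each H cancels one factor of F, leaving (b E(bs) - a E(as))/(b-a), which Binet's
formula reads back as ∑ `fibPoly` · e_n s^n. -/
theorem multSeries_quadratic_add_sum {K : Type*} [Field K] {a b : K} (hab : a + b = 1)
    (hne : b - a ≠ 0) (n : ℕ) :
    multSeries ((1 + C a * X) * (1 + C b * X)) n +
      ∑ y ∈ antidiagonal n,
        ((-1) ^ y.1 * coeff y.1 (C (-(a * b)) * X ^ 2 * PowerSeries.mk (fibPoly (-(a * b))))) •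
          (multSeries ((1 + C a * X) * (1 + C b * X)) y.2 * h K y.1) =
      fibPoly (-(a * b)) n • e K n := by
  set c := C (-(a * b)) * X ^ 2 * PowerSeries.mk (fibPoly (-(a * b))) with hc
  set W : PowerSeries (Sym K) := PowerSeries.mk fun r => ((-1) ^ r * coeff r c) • h K r with hW
  have h1 : (b - a) • (1 + W) + a • multGen (PowerSeries.mk fun i => (-b) ^ i) =
      b • multGen (PowerSeries.mk fun i => (-a) ^ i) := by
    ext1 r
    rw [multGen_geom, multGen_geom, map_add, coeff_smul, coeff_smul, coeff_smul, coeff_mk, coeff_mk,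
      map_add, hW, coeff_mk, coeff_one, hc, mul_assoc, coeff_C_mul]
    rcases r with _ | _ | r
    · simp [coeff_X_pow_mul', h_zero, ← add_smul]
    · simp [coeff_X_pow_mul', smul_smul, mul_comm]
    · rw [if_neg (by omega), zero_add, smul_smul, smul_smul, smul_smul, ← add_smul, mul_comm (X ^ 2),
        coeff_mul_X_pow _ 2 r, coeff_mk]
      congr 1
      have := sub_mul_fibPoly hab r
      linear_combination (-(a * b)) * (-1) ^ (r + 2) * this
  have hE : ∀ c : K, multGen (1 + C c * X) = PowerSeries.mk fun n => c ^ n • e K n :=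
    multGen_one_add
  have hmul : multGen ((1 + C a * X) * (1 + C b * X)) =
      multGen (1 + C a * X) * multGen (1 + C b * X) := multGen_mul (by simp) (by simp)
  have h2 : (b - a) • (multGen ((1 + C a * X) * (1 + C b * X)) * (1 + W)) +
      a • multGen (1 + C a * X) = b • multGen (1 + C b * X) := by
    rw [hmul]
    calc _ = multGen (1 + C a * X) * multGen (1 + C b * X) *
          ((b - a) • (1 + W) + a • multGen (PowerSeries.mk fun i => (-b) ^ i)) := by
          rw [mul_add (multGen _ * multGen _) ((b - a) • _), mul_smul_comm, mul_smul_comm, mul_assoc (multGen (1 + C a * X)) _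
            (multGen (PowerSeries.mk _)), mul_comm (multGen (1 + C b * X))
            (multGen (PowerSeries.mk _)), multGen_geom_mul, mul_one]
      _ = _ := by
          rw [h1, mul_smul_comm, mul_right_comm, mul_comm (multGen (1 + C a * X))
            (multGen (PowerSeries.mk _)), multGen_geom_mul, one_mul]
  have h3 := congrArg (coeff n) h2
  rw [hE, hE, map_add, coeff_smul, coeff_smul, coeff_smul, coeff_mk, coeff_mk, mul_add, mul_one,
    map_add, mul_comm _ W, coeff_mul] at h3
  simp only [multGen, hW, coeff_mk, smul_mul_assoc] at h3
  -- Distinct roots are needed only here, to divide by b - a.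
  refine (IsUnit.mk0 _ hne).smul_left_cancel.1 ?_
  refine add_right_cancel (b := a • a ^ n • e K n) ?_
  have h4 := sub_mul_fibPoly hab n
  rw [smul_smul (b - a), h4, smul_smul, ← pow_succ', ← add_smul, sub_add_cancel, pow_succ' b,
    ← smul_smul b, ← h3, pow_succ', ← smul_smul a]
  simp only [mul_comm (h K _)]

/-! ### Comparing powers of u: the recurrence. -/

theorem creation_smul {K : Type*} [Field K] [CharZero K] (q : K) (a : ℤ) (c : K) (f : Sym K) :
    creation q a (c • f) = c • creation q a f := by
  rw [creation, creation, shift_smul, mul_assoc, HahnSeries.C_apply, HahnSeries.coeff_single_mul,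
    sub_zero, ← Algebra.smul_def, smul_comm]

theorem creation_sum {K : Type*} [Field K] [CharZero K] (q : K) (a : ℤ) {ι : Type*} (s : Finset ι)
    (f : ι → Sym K) : creation q a (∑ i ∈ s, f i) = ∑ i ∈ s, creation q a (f i) := by
  simp only [creation]
  rw [map_sum, Finset.sum_mul, HahnSeries.coeff_sum, Finset.smul_sum]

/-- The factor u X^2 shifts i by one, which is the source of the i - 1 in the binomials and of the
range i ≥ 1. -/
theorem coeff_twoColumnWeight {K : Type*} [Field K] (u : K) (r : ℕ) :
    coeff r (C u * X ^ 2 * PowerSeries.mk (fibPoly u)) =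
      ∑ x ∈ (twoColumnPairs r).filter (1 ≤ ·.1),
        ((x.1 - 1 + x.2).choose (x.1 - 1) : K) * u ^ x.1 := by
  rw [mul_assoc, coeff_C_mul]
  rcases lt_or_ge r 2 with hr | hr
  · rw [coeff_X_pow_mul', if_neg (by omega), mul_zero]
    symm
    refine Finset.sum_eq_zero fun x hx => ?_
    obtain ⟨h1, h2⟩ := Finset.mem_filter.1 hx
    rw [mem_twoColumnPairs] at h1
    omega
  · obtain ⟨r, rfl⟩ := Nat.exists_eq_add_of_le' hr
    rw [coeff_X_pow_mul, coeff_mk, fibPoly_eq_sum, Finset.mul_sum]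
    refine Finset.sum_nbij' (fun x => (x.1 + 1, x.2)) (fun x => (x.1 - 1, x.2)) ?_ ?_ ?_ ?_ ?_
    · intro x hx
      rw [mem_twoColumnPairs] at hx
      rw [Finset.mem_filter, mem_twoColumnPairs]
      simp only
      omega
    · intro x hx
      rw [Finset.mem_filter, mem_twoColumnPairs] at hx
      rw [mem_twoColumnPairs]
      simp only
      omega
    · intro x _
      simp
    · intro x hx
      have := (Finset.mem_filter.1 hx).2
      ext <;> simp only
      omega
    · intro x _
      simp only [Nat.add_sub_cancel]
      ring

theorem sum_twoColumnPairs_reindex {M : Type*} [AddCommMonoid M] (g : ℕ → ℕ → ℕ → ℕ → M) (n : ℕ) :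
    ∑ y ∈ antidiagonal n, ∑ x ∈ (twoColumnPairs y.1).filter (1 ≤ ·.1), ∑ w ∈ twoColumnPairs y.2,
        g x.1 x.2 w.1 w.2 =
      ∑ x ∈ twoColumnPairs n, ∑ i ∈ Icc 1 x.1, ∑ j ∈ Icc 0 x.2, g i j (x.1 - i) (x.2 - j) := by
  simp only [← Finset.sum_product']
  rw [Finset.sum_sigma', Finset.sum_sigma']
  refine Finset.sum_bij'
    (fun z _ => ⟨(z.2.1.1 + z.2.2.1, z.2.1.2 + z.2.2.2), (z.2.1.1, z.2.1.2)⟩)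
    (fun z _ => ⟨(2 * z.2.1 + z.2.2, 2 * (z.1.1 - z.2.1) + (z.1.2 - z.2.2)),
      ((z.2.1, z.2.2), (z.1.1 - z.2.1, z.1.2 - z.2.2))⟩) ?_ ?_ ?_ ?_ ?_
  · rintro ⟨⟨r, t⟩, ⟨i, j⟩, k, l⟩ hz
    simp only [Finset.mem_sigma, Finset.mem_product, Finset.mem_filter, mem_twoColumnPairs,
      HasAntidiagonal.mem_antidiagonal, Finset.mem_Icc] at hz ⊢
    omega
  · rintro ⟨⟨k, l⟩, i, j⟩ hz
    simp only [Finset.mem_sigma, Finset.mem_product, Finset.mem_filter, mem_twoColumnPairs,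
      HasAntidiagonal.mem_antidiagonal, Finset.mem_Icc, and_true, true_and] at hz ⊢
    omega
  · rintro ⟨⟨r, t⟩, ⟨i, j⟩, k, l⟩ hz
    simp only [Finset.mem_sigma, Finset.mem_product, Finset.mem_filter, mem_twoColumnPairs,
      HasAntidiagonal.mem_antidiagonal] at hz
    simp only [Nat.add_sub_cancel_left, hz.2.1.1, hz.2.2]
  · rintro ⟨⟨k, l⟩, i, j⟩ hz
    simp only [Finset.mem_sigma, Finset.mem_product, Finset.mem_Icc] at hz
    simp only [Nat.add_sub_cancel' hz.2.1.2, Nat.add_sub_cancel' hz.2.2.2]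
  · rintro ⟨⟨r, t⟩, ⟨i, j⟩, k, l⟩ hz
    simp only [Nat.add_sub_cancel_left]

/-- For fixed n, k determines l, so after taking a coefficient at x^d both sides are polynomials in
u whose u^k coefficient is one term. They agree at the infinitely many values a(a+1), hence
coincide. -/
theorem eq_of_sum_twoColumnPairs_eq {K : Type*} [Field K] [CharZero K] (n : ℕ)
    (F G : ℕ → ℕ → Sym K)
    (hFG : ∀ a : ℕ, ∑ x ∈ twoColumnPairs n, ((a * (a + 1) : ℕ) : K) ^ x.1 • F x.1 x.2 =
      ∑ x ∈ twoColumnPairs n, ((a * (a + 1) : ℕ) : K) ^ x.1 • G x.1 x.2)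
    {k l : ℕ} (hkl : 2 * k + l = n) : F k l = G k l := by
  refine Subtype.ext (MvPowerSeries.ext fun d => ?_)
  set φ : Sym K →ₗ[K] K := (MvPowerSeries.coeff d).comp (Sym K).val.toLinearMap with hφ
  change φ (F k l) = φ (G k l)
  set P : Polynomial K := ∑ x ∈ twoColumnPairs n,
    Polynomial.monomial x.1 (φ (F x.1 x.2) - φ (G x.1 x.2)) with hP
  have hP0 : P = 0 := by
    refine Polynomial.eq_zero_of_infinite_isRoot P ?_
    refine Set.Infinite.mono ?_
      (Set.infinite_range_of_injective (f := fun a : ℕ => ((a * (a + 1) : ℕ) : K)) ?_)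
    · rintro _ ⟨a, rfl⟩
      have h1 := congrArg φ (hFG a)
      simp only [map_sum, map_smul, smul_eq_mul] at h1
      rw [Set.mem_ofPred_eq, Polynomial.IsRoot, hP, Polynomial.eval_finsetSum]
      simp only [Polynomial.eval_monomial, sub_mul, Finset.sum_sub_distrib]
      rw [sub_eq_zero]
      simpa only [mul_comm] using h1
    · intro a b hab
      have hab' : a * (a + 1) = b * (b + 1) := Nat.cast_injective (R := K) hab
      nlinarith [Nat.le_total a b]
  have hc := congrArg (Polynomial.coeff · k) hP0
  simp only [hP, Polynomial.finsetSum_coeff, Polynomial.coeff_monomial, Polynomial.coeff_zero] at hc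
  rw [Finset.sum_eq_single (k, l)] at hc
  · rw [if_pos rfl] at hc
    exact sub_eq_zero.1 hc
  · rintro ⟨k', l'⟩ hx hne
    rw [mem_twoColumnPairs] at hx
    rw [if_neg]
    rintro rfl
    simp only at hx
    exact hne (by rw [show l' = l by omega])
  · intro hnot
    exact absurd (mem_twoColumnPairs.2 hkl) hnot

/-- The recurrence for `(-1)^k m_{2^k 1^l}` in terms of creation operators. -/
theorem signedTwoColumn_recurrence {K : Type*} [Field K] [CharZero K] {q : K} (hq : q ≠ 0)
    (k l : ℕ) :
    signedTwoColumn K k l = ((k + l).choose k : K) • e K (2 * k + l) +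
      q • ∑ i ∈ Icc 1 k, ∑ j ∈ Icc 0 l, ((i - 1 + j).choose (i - 1) : K) •
        creation q (2 * (i : ℤ) + (j : ℤ)) (signedTwoColumn K (k - i) (l - j)) := by
  refine eq_of_sum_twoColumnPairs_eq (2 * k + l) (signedTwoColumn K)
    (fun k' l' => ((k' + l').choose k' : K) • e K (2 * k + l) +
      q • ∑ i ∈ Icc 1 k', ∑ j ∈ Icc 0 l', ((i - 1 + j).choose (i - 1) : K) •
        creation q (2 * (i : ℤ) + (j : ℤ)) (signedTwoColumn K (k' - i) (l' - j))) ?_ rfl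
  intro s
  set n := 2 * k + l
  -- The values u = s(s+1) are those for which 1 + X - uX^2 splits with integer a and b; no square
  -- roots need be adjoined to `K`.
  set a : K := (s : K) + 1 with ha
  set b : K := -(s : K) with hb
  have hab : a + b = 1 := by rw [ha, hb]; ring
  have hne : b - a ≠ 0 := by
    have : ((2 * s + 1 : ℕ) : K) ≠ 0 := Nat.cast_ne_zero.2 (Nat.succ_ne_zero _)
    intro h0
    apply this
    push_cast
    linear_combination -h0
  have hu : ((s * (s + 1) : ℕ) : K) = -(a * b) := by rw [ha, hb]; push_cast; ring
  rw [hu]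
  set u : K := -(a * b) with hu'
  set φ : PowerSeries K := (1 + C a * X) * (1 + C b * X) with hφ
  have hs : ShiftsTo q φ :=
    (shiftsTo_one_add q a).mul (by simp) (by simp) (shiftsTo_one_add q b)
  have hc : rescale (-1) (C u * X ^ 2 * PowerSeries.mk (fibPoly u)) * φ = C u * X ^ 2 := by
    have hX : rescale (-1 : K) (C u * X ^ 2) = C u * X ^ 2 := by
      ext1 r
      rw [coeff_rescale, coeff_C_mul_X_pow]
      split_ifs with h2
      · rw [h2]; simp
      · rw [mul_zero]
    rw [map_mul, hX, mul_assoc, fibPoly_mul hab, mul_one]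
  have h1 := sum_creation_multSeries hq (by simp [hφ]) hs hc n
  have h2 := multSeries_quadratic_add_sum hab hne n
  rw [← hφ, ← hu'] at h2
  have h3 : fibPoly u n • e K n + q • ∑ y ∈ antidiagonal n,
      coeff y.1 (C u * X ^ 2 * PowerSeries.mk (fibPoly u)) •
        creation q (y.1 : ℤ) (multSeries φ y.2) = multSeries φ n := by
    rw [h1, ← h2, smul_smul]
    -- The monomial has degree 2, so the prefactor is -q·q^{-2}; the q in the recurrence is what
    -- normalises it to -1.
    have : q * (-q * q⁻¹ ^ 2) = -1 := by field_simp
    rw [this, neg_smul, one_smul, add_neg_cancel_right]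
  rw [← multSeries_quadratic hab, ← hφ, ← h3, fibPoly_eq_sum, Finset.sum_smul]
  simp only [smul_add, Finset.sum_add_distrib]
  congr 1
  · refine Finset.sum_congr rfl fun x _ => ?_
    rw [smul_smul, mul_comm]
  · have hr := sum_twoColumnPairs_reindex (fun i j k' l' =>
      (((i - 1 + j).choose (i - 1) : K) * u ^ (i + k')) •
        creation q (2 * (i : ℤ) + (j : ℤ)) (signedTwoColumn K k' l')) n
    simp only [smul_comm _ q, ← Finset.smul_sum]
    congr 1
    refine Eq.trans ?_ (hr.trans ?_)
    · refine Finset.sum_congr rfl fun y _ => ?_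
      rw [coeff_twoColumnWeight, Finset.sum_smul]
      refine Finset.sum_congr rfl fun x hx => ?_
      have hx' := mem_twoColumnPairs.1 (Finset.mem_filter.1 hx).1
      have hz : (y.1 : ℤ) = 2 * (x.1 : ℤ) + (x.2 : ℤ) := by rw [← hx']; push_cast; rfl
      rw [hφ, multSeries_quadratic hab, creation_sum, Finset.smul_sum]
      refine Finset.sum_congr rfl fun w _ => ?_
      rw [creation_smul, smul_smul, hz, mul_assoc, ← pow_add]
    · refine Finset.sum_congr rfl fun x _ => ?_
      rw [Finset.smul_sum]
      refine Finset.sum_congr rfl fun i hi => ?_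
      rw [Finset.smul_sum]
      refine Finset.sum_congr rfl fun j _ => ?_
      rw [smul_smul, Nat.add_sub_cancel' (Finset.mem_Icc.1 hi).2, mul_comm]

/-! ### Positivity of the C-expansion. -/

/-- The symmetric functions of the form `∑ c_α C_α`, over the compositions `α` of `n`, with
coefficients `c_α` in `ℕ[q]`. -/
def creationCone {K : Type*} [Field K] [CharZero K] (q : K) (n : ℕ) : AddSubmonoid (Sym K) where
  carrier := {f | ∃ c : Composition n → Polynomial ℕ,
    f = ∑ α : Composition n, Polynomial.aeval q (c α) • creationComp q α}
  zero_mem' := ⟨0, by simp⟩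
  add_mem' := by
    rintro _ _ ⟨c, rfl⟩ ⟨d, rfl⟩
    exact ⟨c + d, by simp [add_smul, Finset.sum_add_distrib]⟩

theorem smul_mem_creationCone {K : Type*} [Field K] [CharZero K] {q : K} {n : ℕ} {f : Sym K}
    (P : Polynomial ℕ) (hf : f ∈ creationCone q n) :
    Polynomial.aeval q P • f ∈ creationCone q n := by
  obtain ⟨c, rfl⟩ := hf
  exact ⟨fun α => P * c α, by simp [Finset.smul_sum, smul_smul]⟩

theorem natCast_smul_mem_creationCone {K : Type*} [Field K] [CharZero K] {q : K} {n : ℕ}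
    {f : Sym K} (a : ℕ) (hf : f ∈ creationCone q n) : (a : K) • f ∈ creationCone q n := by
  simpa using smul_mem_creationCone (a : Polynomial ℕ) hf

theorem base_smul_mem_creationCone {K : Type*} [Field K] [CharZero K] {q : K} {n : ℕ}
    {f : Sym K} (hf : f ∈ creationCone q n) : q • f ∈ creationCone q n := by
  have := smul_mem_creationCone Polynomial.X hf
  rwa [Polynomial.aeval_X] at this

theorem creationComp_mem_creationCone {K : Type*} [Field K] [CharZero K] (q : K) {n : ℕ}
    (α : Composition n) : creationComp q α ∈ creationCone q n := by
  refine ⟨Pi.single α 1, ?_⟩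
  rw [Finset.sum_eq_single α]
  · simp
  · intro β _ hβ
    rw [Pi.single_eq_of_ne hβ, map_zero, zero_smul]
  · intro hα
    exact absurd (Finset.mem_univ α) hα

/-- By linearity it suffices to treat C_α, and C_a C_α is indexed by α with the part a prepended; a
must be positive for this to be a composition. -/
theorem creation_mem_creationCone {K : Type*} [Field K] [CharZero K] {q : K} {a n N : ℕ}
    (ha : 0 < a) (hN : a + n = N) {f : Sym K} (hf : f ∈ creationCone q n) :
    creation q (a : ℤ) f ∈ creationCone q N := by
  obtain ⟨c, rfl⟩ := hf
  rw [creation_sum]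
  refine sum_mem fun α _ => ?_
  rw [creation_smul]
  refine smul_mem_creationCone _ ?_
  exact creationComp_mem_creationCone q (⟨a :: α.blocks, by
      intro i hi
      rcases List.mem_cons.1 hi with rfl | hi
      · exact ha
      · exact α.blocks_pos hi, by
      rw [List.sum_cons, α.blocks_sum, hN]⟩ : Composition N)

theorem e_mem_creationCone {K : Type*} [Field K] [CharZero K] {q : K} (hq : q ≠ 0) (n : ℕ) :
    e K n ∈ creationCone q n := by
  induction n using Nat.strong_induction_on with
  | _ n ih =>
    rcases n with _ | n
    · rw [e_zero]
      exact creationComp_mem_creationCone q (⟨[], by simp, rfl⟩ : Composition 0)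
    · rw [e_eq_sum_creation hq]
      refine sum_mem fun y hy => ?_
      rw [HasAntidiagonal.mem_antidiagonal] at hy
      exact creation_mem_creationCone (Nat.succ_pos _) (by omega) (ih y.2 (by omega))

/-- Every term of the recurrence has i ≥ 1, so strong induction on k for all l applies; for k = 0
only the e_l term is left. -/
theorem signedTwoColumn_mem_creationCone {K : Type*} [Field K] [CharZero K] {q : K} (hq : q ≠ 0)
    (k l : ℕ) : signedTwoColumn K k l ∈ creationCone q (2 * k + l) := by
  induction k using Nat.strong_induction_on generalizing l with
  | _ k ih =>
    rw [signedTwoColumn_recurrence hq]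
    refine add_mem (natCast_smul_mem_creationCone _ (e_mem_creationCone hq _)) ?_
    refine base_smul_mem_creationCone ?_
    refine sum_mem fun i hi => sum_mem fun j hj => natCast_smul_mem_creationCone _ ?_
    rw [Finset.mem_Icc] at hi hj
    have hz : 2 * (i : ℤ) + (j : ℤ) = ((2 * i + j : ℕ) : ℤ) := by push_cast; rfl
    rw [hz]
    exact creation_mem_creationCone (by omega) (by omega) (ih (k - i) (by omega) (l - j))

/-- The ℕ-algebra structure found for a general field and the one found for `Qqt` may differ
syntactically; such structures are unique. -/
theorem aeval_eq_aeval_of_natAlgebra {R : Type*} [CommSemiring R] (i j : Algebra ℕ R) (x : R)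
    (P : Polynomial ℕ) :
    @Polynomial.aeval ℕ R _ _ i x P = @Polynomial.aeval ℕ R _ _ j x P := by
  rw [Subsingleton.elim i j]

theorem q_ne_zero : q ≠ 0 := by
  rw [q, Ne, FaithfulSMul.algebraMap_eq_zero_iff]
  exact MvPolynomial.X_ne_zero 0

end SymFn

end

open SymFn in
theorem theorem1p5 (k l : ℕ) (hk : 1 ≤ k) :
    ((-1) ^ k * m Qqt (twoColumn k l) =
      ((k + l).choose k : Qqt) • e Qqt (2 * k + l) +
        q • ∑ i ∈ Finset.Icc 1 k, ∑ j ∈ Finset.Icc 0 l,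
          ((i - 1 + j).choose (i - 1) : Qqt) •
            creation q (2 * (i : ℤ) + (j : ℤ))
              ((-1) ^ (k - i) * m Qqt (twoColumn (k - i) (l - j)))) ∧
    ∃ c : Composition (2 * k + l) → Polynomial ℕ,
      (-1) ^ k * m Qqt (twoColumn k l) =
        ∑ α : Composition (2 * k + l), Polynomial.aeval q (c α) • creationComp q α := by
  refine ⟨signedTwoColumn_recurrence q_ne_zero k l, ?_⟩
  obtain ⟨c, hc⟩ := signedTwoColumn_mem_creationCone q_ne_zero k l
  refine ⟨c, hc.trans (Finset.sum_congr rfl fun α _ => ?_)⟩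
  exact congrArg (· • creationComp q α) (aeval_eq_aeval_of_natAlgebra _ _ q (c α))
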